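/- Let $(\alpha,\beta)\in\{(4,8),(8,4)\}$, and call $x,y\in\mathbb{Z}^2$ $4$-adjacent if $|x_1-y_1|+|x_2-y_2|=1$ and $8$-adjacent if $\max\{|x_1-y_1|,|x_2-y_2|\}=1$. A binary image is a map $I$ from a subset of $\mathbb{Z}^2$ to $\{\text{black},\text{white}\}$; its graph $I_\alpha$ has the domain of $I$ as vertex set and joins white pixels that are $\alpha$-adjacent and black pixels that are $\beta$-adjacent. A white $\alpha$-connected component of $I$ is a maximal nonempty set of white pixels that induces a connected subgraph of $I_\alpha$. For a finite nonempty $\alpha$-connected set $T\subset\mathbb{Z}^2$ define: - the site perimeter $P_\alpha(T)$, the set of points of $\mathbb{Z}^2\setminus T$ that are $\alpha$-adjacent to a point of $T$; - $G_\alpha(T)$, the graph $J_\alpha$ of the image $J$ on $\mathbb{Z}^2$ whose black pixels are exactly those of $P_\alpha(T)$; - $E_\alpha(T)$, the unique infinite white $\alpha$-connected component of $G_\alpha(T)$; - $P_\alpha^{ext}(T)$, the subgraph of $G_\alpha(T)$ induced by the points of $P_\alpha(T)$ that are $\alpha$-adjacent to a point of $E_\alpha(T)$ (it is a simple cycle,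 hence its straight-line embedding in $\mathbb{R}^2$ is a simple polygon); - $V_\alpha(T)\subset\mathbb{R}^2$, the open region enclosed by this polygon, i.e. the union of the bounded connected components of the complement of the embedding of $P_\alpha^{ext}(T)$, and $Z_\alpha(T):=V_\alpha(T)\cap\mathbb{Z}^2$; - the polygonal tile $$\mathscr{P}_\alpha(T):=V_\alpha(T)\setminus\bigcup_{\tau\in\mathcal{M}}V_\alpha(\tau),$$ where $\mathcal{M}$ is the set of all (vertex sets of) white $\alpha$-connected subgraphs of $G_\alpha(T)$ contained in $Z_\alpha(T)\setminus T$. Then for any two distinct finite white $\alpha$-connected components $T_1,T_2$ of a binary image, $$\mathscr{P}_\alpha(T_1)\cap\mathscr{P}_\alpha(T_2)=\emptyset.$$ -/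

import Mathlib

/-- The two notions of connectivity on `ℤ²`. -/
inductive Connectivity where
  | four
  | eight

/-- The dual notion of connectivity: `4 ↔ 8`. -/
def Connectivity.dual : Connectivity → Connectivity
  | .four => .eight
  | .eight => .four

/-- `d_4` is the `ℓ₁` metric on `ℤ²` and `d_8` is the `ℓ_∞` metric. -/
def pixelDist : Connectivity → ℤ × ℤ → ℤ × ℤ → ℤ
  | .four, x, y => |x.1 - y.1| + |x.2 - y.2|
  | .eight, x, y => max |x.1 - y.1| |x.2 - y.2|

/-- Two pixels are `α`-adjacent if their `d_α`-distance is `1`. -/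
def PixelAdj (α : Connectivity) (x y : ℤ × ℤ) : Prop :=
  pixelDist α x y = 1

theorem PixelAdj.symm {α : Connectivity} {x y : ℤ × ℤ} (h : PixelAdj α x y) :
    PixelAdj α y x := by
  cases α <;> simpa only [PixelAdj, pixelDist, abs_sub_comm] using h

theorem PixelAdj.ne {α : Connectivity} {x y : ℤ × ℤ} (h : PixelAdj α x y) : x ≠ y := by
  rintro rfl
  cases α <;> simp [PixelAdj, pixelDist] at h

inductive PixelColor where
  | black
  | white

/-- A binary image: a map from a subset of `ℤ²` to `{black, white}`. -/
structure BinaryImage where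
  domain : Set (ℤ × ℤ)
  color : domain → PixelColor

namespace BinaryImage

/-- The set of pixels of a given color. -/
def pixels (I : BinaryImage) (c : PixelColor) : Set (ℤ × ℤ) :=
  {z | ∃ h : z ∈ I.domain, I.color ⟨z, h⟩ = c}

/-- The graph `I_α`: white pixels are joined when `α`-adjacent, black pixels when adjacent for the
dual connectivity. Points outside the domain are neither white nor black and have no edges. -/
def graph (I : BinaryImage) (α : Connectivity) : SimpleGraph (ℤ × ℤ) where
  Adj x y :=
    (x ∈ I.pixels .white ∧ y ∈ I.pixels .white ∧ PixelAdj α x y) ∨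
      (x ∈ I.pixels .black ∧ y ∈ I.pixels .black ∧ PixelAdj α.dual x y)
  symm := ⟨fun _ _ h => h.imp (fun h => ⟨h.2.1, h.1, h.2.2.symm⟩) (fun h => ⟨h.2.1, h.1, h.2.2.symm⟩)⟩
  loopless := ⟨fun _ h => h.elim (fun h => h.2.2.ne rfl) (fun h => h.2.2.ne rfl)⟩

/-- The (nonempty) vertex sets of white `α`-connected subgraphs of `I_α`. -/
def IsWhiteConnected (I : BinaryImage) (α : Connectivity) (S : Set (ℤ × ℤ)) : Prop :=
  S ⊆ I.pixels .white ∧ ((I.graph α).induce S).Connected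

/-- White `α`-connected components: the maximal white `α`-connected sets of pixels. -/
def IsWhiteComponent (I : BinaryImage) (α : Connectivity) (T : Set (ℤ × ℤ)) : Prop :=
  Maximal (I.IsWhiteConnected α) T

end BinaryImage

/-- The site perimeter `P_α(T)`: the pixels outside `T` that are `α`-adjacent to `T`. -/
def sitePerimeter (α : Connectivity) (T : Set (ℤ × ℤ)) : Set (ℤ × ℤ) :=
  {z | z ∉ T ∧ ∃ t ∈ T, PixelAdj α z t}

open Classical in
/-- The image on all of `ℤ²` whose black pixels are exactly those of `P_α(T)`. -/
noncomputable def charImage (α : Connectivity) (T : Set (ℤ × ℤ)) : BinaryImage where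
  domain := Set.univ
  color z := if (z : ℤ × ℤ) ∈ sitePerimeter α T then .black else .white

/-- The characteristic graph `G_α(T)` of the site perimeter of `T`. -/
noncomputable def charGraph (α : Connectivity) (T : Set (ℤ × ℤ)) : SimpleGraph (ℤ × ℤ) :=
  (charImage α T).graph α

/-- `E_α(T)`: the infinite white `α`-connected component of `G_α(T)`. It is written as the union of
all such components; for finite `T` there is exactly one. -/
def exteriorRegion (α : Connectivity) (T : Set (ℤ × ℤ)) : Set (ℤ × ℤ) :=
  ⋃₀ {C | (charImage α T).IsWhiteComponent α C ∧ C.Infinite}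

/-- The vertices of the exterior site perimeter `P_α^ext(T)`. -/
def exteriorSitePerimeter (α : Connectivity) (T : Set (ℤ × ℤ)) : Set (ℤ × ℤ) :=
  {z | z ∈ sitePerimeter α T ∧ ∃ e ∈ exteriorRegion α T, PixelAdj α z e}

/-- The inclusion of `ℤ²` in `ℝ²`. -/
def toPlane (z : ℤ × ℤ) : ℝ × ℝ := ((z.1 : ℝ), (z.2 : ℝ))

/-- The straight-line embedding in `ℝ²` of the subgraph of `G` induced by `S`. -/
def graphEmbedding (G : SimpleGraph (ℤ × ℤ)) (S : Set (ℤ × ℤ)) : Set (ℝ × ℝ) :=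
  toPlane '' S ∪
    {x | ∃ u ∈ S, ∃ v ∈ S, G.Adj u v ∧ x ∈ segment ℝ (toPlane u) (toPlane v)}

/-- The polygonal curve in `ℝ²` given by the subgraph of `G_α(T)` induced by `P_α^ext(T)`. -/
def boundaryPolygon (α : Connectivity) (T : Set (ℤ × ℤ)) : Set (ℝ × ℝ) :=
  graphEmbedding (charGraph α T) (exteriorSitePerimeter α T)

/-- `V_α(T)`: the open region enclosed by the polygon `P_α^ext(T)`, that is, the points off the
polygon whose connected component in the complement of the polygon is bounded. -/
def polygonRegion (α : Connectivity) (T : Set (ℤ × ℤ)) : Set (ℝ × ℝ) :=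
  {x | x ∉ boundaryPolygon α T ∧
    Bornology.IsBounded (connectedComponentIn (boundaryPolygon α T)ᶜ x)}

/-- `Z_α(T) = V_α(T) ∩ ℤ²`. -/
def latticeRegion (α : Connectivity) (T : Set (ℤ × ℤ)) : Set (ℤ × ℤ) :=
  toPlane ⁻¹' polygonRegion α T

/-- The family `ℳ` of white `α`-connected subgraphs of `G_α(T)` contained in `Z_α(T) \ T`. -/
def nestedFamily (α : Connectivity) (T : Set (ℤ × ℤ)) : Set (Set (ℤ × ℤ)) :=
  {τ | (charImage α T).IsWhiteConnected α τ ∧ τ ⊆ latticeRegion α T \ T}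

/-- The polygonal tile of `T`, as a subset of `ℝ²`. -/
def polygonalTile (α : Connectivity) (T : Set (ℤ × ℤ)) : Set (ℝ × ℝ) :=
  polygonRegion α T \ ⋃ τ ∈ nestedFamily α T, polygonRegion α τ

/-! For a finite set `T`, label a pixel -1 on the exterior region, 0 on the exterior site perimeter
and 1 elsewhere; `α`-adjacent pixels never carry the labels -1 and 1. Let H_T (`labelInterp`) be the
bilinear interpolation of the labels on the unit squares. Its sign replaces a Jordan curve theorem
for the polygon of `T`: (a) off the polygon, H_T > 0 implies enclosed, because the set H_T > 0 is
bounded and its frontier lies in the polygon (`mem_polygonRegion_of_labelInterp_pos`); (b) for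
connected `T`, H_T ≥ 0 on V(T), because a point with H_T < 0 off the polygon can be joined to the
infinite exterior region without meeting the polygon (`labelInterp_nonneg_of_mem_polygonRegion`).
Part (b) needs that the label 0 does not fill three corners of a unit square (`α = 4`) or all four
(`α = 8`). Otherwise `T`, the exterior region and the centroid of a lattice triangle would all be
joined to its three corners, a planar drawing of K_{3,3}; `not_three_common_neighbors` excludes this
by winding angles.

If one component is not contained in the exterior region of the other, it belongs to the family ℳ of
the other, whose tile therefore omits it and its region. Otherwise each lies in the exterior region
of the other. Suppose x lies in the tile of `T₁` and in V(`T₂`). By (b), some pixel z next to x has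
label 1 for both sets. Let D be the `α`-component of z among such pixels. Then D belongs to ℳ for
`T₁`, its polygon is part of that of `T₁`, and H_D(x) > 0; so x lies in V(D) by (a), which the tile
omits. -/

theorem PixelAdj.of_four {α : Connectivity} {x y : ℤ × ℤ} (h : PixelAdj .four x y) :
    PixelAdj α x y := by
  cases α
  · exact h
  · simp only [PixelAdj, pixelDist] at h ⊢
    grind

theorem PixelAdj.to_eight {α : Connectivity} {x y : ℤ × ℤ} (h : PixelAdj α x y) :
    PixelAdj .eight x y := by
  cases α
  · exact h.of_four
  · exact h

/-! ### Paths of pixels. -/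

/-- One `α`-step between two pixels of `S`. -/
def PixelStep (α : Connectivity) (S : Set (ℤ × ℤ)) (u v : ℤ × ℤ) : Prop :=
  u ∈ S ∧ v ∈ S ∧ PixelAdj α u v

/-- Two pixels are linked by an `α`-path all of whose steps stay in `S`. -/
def PixelLinked (α : Connectivity) (S : Set (ℤ × ℤ)) : ℤ × ℤ → ℤ × ℤ → Prop :=
  Relation.ReflTransGen (PixelStep α S)

namespace PixelLinked

variable {α : Connectivity} {S S' : Set (ℤ × ℤ)} {u v w : ℤ × ℤ}

theorem symm (h : PixelLinked α S u v) : PixelLinked α S v u := by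
  induction h with
  | refl => exact .refl
  | tail _ hs ih => exact .head ⟨hs.2.1, hs.1, hs.2.2.symm⟩ ih

theorem mono (hS : S ⊆ S') (h : PixelLinked α S u v) : PixelLinked α S' u v := by
  induction h with
  | refl => exact .refl
  | tail _ hs ih => exact ih.tail ⟨hS hs.1, hS hs.2.1, hs.2.2⟩

/-- A property that is inherited along `α`-steps in `S` is inherited along `α`-paths in `S`. -/
theorem induct (h : PixelLinked α S u v) {p : ℤ × ℤ → Prop} (hu : p u)
    (hp : ∀ a b, p a → a ∈ S → b ∈ S → PixelAdj α a b → p b) : p v := by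
  induction h with
  | refl => exact hu
  | tail _ hs ih => exact hp _ _ ih hs.1 hs.2.1 hs.2.2

theorem mem (h : PixelLinked α S u v) (hu : u ∈ S) : v ∈ S :=
  h.induct hu fun _ _ _ _ hb _ => hb

/-- An `α`-path in `S` is an `α`-path in the set of pixels linked to its start. -/
theorem linked_component (h : PixelLinked α S u v) :
    PixelLinked α {w | PixelLinked α S u w} u v := by
  induction h with
  | refl => exact .refl
  | tail hs hst ih => exact ih.tail ⟨hs, hs.tail hst, hst.2.2⟩

end PixelLinked

/-! ### White components in terms of paths. -/

namespace BinaryImage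

variable {α : Connectivity} {I : BinaryImage} {S : Set (ℤ × ℤ)} {u v : ℤ × ℤ}

theorem not_black_of_white (h : u ∈ I.pixels .white) : u ∉ I.pixels .black := by
  rintro ⟨h1, h2⟩
  obtain ⟨h3, h4⟩ := h
  rw [h2] at h4
  cases h4

theorem graph_adj_of_white (hu : u ∈ I.pixels .white) :
    (I.graph α).Adj u v ↔ v ∈ I.pixels .white ∧ PixelAdj α u v := by
  constructor
  · rintro (h | h)
    · exact h.2
    · exact absurd h.1 (not_black_of_white hu)
  · intro h
    exact Or.inl ⟨hu, h⟩

theorem isWhiteConnected_iff :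
    I.IsWhiteConnected α S ↔
      S ⊆ I.pixels .white ∧ S.Nonempty ∧ ∀ u ∈ S, ∀ v ∈ S, PixelLinked α S u v := by
  refine and_congr_right fun hS => ?_
  rw [SimpleGraph.connected_iff]
  rw [and_comm, Set.nonempty_coe_sort]
  refine and_congr_right fun _ => ?_
  constructor
  · intro h u hu v hv
    obtain ⟨p⟩ := h ⟨u, hu⟩ ⟨v, hv⟩
    suffices ∀ a b : S, ((I.graph α).induce S).Walk a b → PixelLinked α S a b from this _ _ p
    intro a b p
    induction p with
    | nil => exact .refl
    | cons hab _ ih =>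
      exact .head ⟨Subtype.prop _, Subtype.prop _,
        ((graph_adj_of_white (hS (Subtype.prop _))).1 hab).2⟩ ih
  · rintro h ⟨u, hu⟩ ⟨v, hv⟩
    suffices ∀ w, PixelLinked α S u w → ∀ hw : w ∈ S,
        ((I.graph α).induce S).Reachable ⟨u, hu⟩ ⟨w, hw⟩ from this v (h u hu v hv) hv
    intro w hw
    induction hw with
    | refl => intro _; exact .refl _
    | tail _ hs ih =>
      intro hw
      exact (ih hs.1).trans
        (SimpleGraph.Adj.reachable ((graph_adj_of_white (hS hs.1)).2 ⟨hS hw, hs.2.2⟩))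

/-- The `α`-component of a white pixel is a white component of the image. -/
theorem isWhiteComponent_linked (hu : u ∈ I.pixels .white) :
    I.IsWhiteComponent α {w | PixelLinked α (I.pixels .white) u w} := by
  refine ⟨isWhiteConnected_iff.2 ⟨fun w hw => hw.mem hu, ⟨u, .refl⟩, ?_⟩, ?_⟩
  · intro a ha b hb
    exact ha.linked_component.symm.trans hb.linked_component
  · intro C hC hle c hc
    obtain ⟨h1, _, h3⟩ := isWhiteConnected_iff.1 hC
    exact (h3 u (hle .refl) c hc).mono h1

theorem IsWhiteComponent.eq_linked (hS : I.IsWhiteComponent α S) (hu : u ∈ S) :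
    S = {w | PixelLinked α (I.pixels .white) u w} := by
  obtain ⟨h1, _, h3⟩ := isWhiteConnected_iff.1 hS.prop
  exact hS.eq_of_le (isWhiteComponent_linked (h1 hu)).prop fun c hc => (h3 u hu c hc).mono h1

theorem IsWhiteComponent.mem_of_adj (hS : I.IsWhiteComponent α S) (hu : u ∈ S)
    (hv : v ∈ I.pixels .white) (huv : PixelAdj α u v) : v ∈ S := by
  rw [hS.eq_linked hu]
  exact .single ⟨hS.prop.1 hu, hv, huv⟩

theorem IsWhiteComponent.disjoint_of_ne {S' : Set (ℤ × ℤ)} (hS : I.IsWhiteComponent α S)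
    (hS' : I.IsWhiteComponent α S') (hne : S ≠ S') : Disjoint S S' := by
  rw [Set.disjoint_left]
  intro u hu hu'
  exact hne ((hS.eq_linked hu).trans (hS'.eq_linked hu').symm)

end BinaryImage

/-! ### The exterior region. -/

section Exterior

variable {α : Connectivity} {T : Set (ℤ × ℤ)} {u v z : ℤ × ℤ}

theorem mem_white_charImage : z ∈ (charImage α T).pixels .white ↔ z ∉ sitePerimeter α T := by
  simp [BinaryImage.pixels, charImage]

theorem mem_black_charImage : z ∈ (charImage α T).pixels .black ↔ z ∈ sitePerimeter α T := by
  simp [BinaryImage.pixels, charImage]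

theorem white_charImage : (charImage α T).pixels .white = (sitePerimeter α T)ᶜ :=
  Set.ext fun _ => mem_white_charImage

theorem mem_exteriorRegion : z ∈ exteriorRegion α T ↔
    z ∉ sitePerimeter α T ∧ {w | PixelLinked α (sitePerimeter α T)ᶜ z w}.Infinite := by
  rw [← white_charImage, ← mem_white_charImage]
  constructor
  · rintro ⟨C, ⟨hC, hinf⟩, hz⟩
    exact ⟨hC.prop.1 hz, hC.eq_linked hz ▸ hinf⟩
  · rintro ⟨h1, h2⟩
    exact ⟨_, ⟨BinaryImage.isWhiteComponent_linked h1, h2⟩, .refl⟩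

theorem exteriorRegion_of_linked (hu : u ∈ exteriorRegion α T)
    (h : PixelLinked α (sitePerimeter α T)ᶜ u v) : v ∈ exteriorRegion α T := by
  obtain ⟨h1, h2⟩ := mem_exteriorRegion.1 hu
  refine mem_exteriorRegion.2 ⟨h.mem h1, h2.mono fun w hw => ?_⟩
  exact h.symm.trans hw

theorem exteriorRegion_of_adj (hu : u ∈ exteriorRegion α T) (huv : PixelAdj α u v)
    (hv : v ∉ sitePerimeter α T) : v ∈ exteriorRegion α T :=
  exteriorRegion_of_linked hu (.single ⟨(mem_exteriorRegion.1 hu).1, hv, huv⟩)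

/-- A white path leaving `T` would step onto the site perimeter, so the component of a pixel of `T`
stays in the finite set `T`. -/
theorem not_mem_exteriorRegion_of_mem (hT : T.Finite) (hz : z ∈ T) : z ∉ exteriorRegion α T := by
  intro h
  refine (mem_exteriorRegion.1 h).2 (hT.subset fun w hw => ?_)
  refine PixelLinked.induct hw hz fun a b ha _ hb hab => ?_
  by_contra hbT
  exact hb ⟨hbT, a, ha, hab.symm⟩

/-- A connected set off the site perimeter that is not inside the exterior region avoids it. -/
theorem subset_exteriorRegion_or_disjoint {S : Set (ℤ × ℤ)}
    (hS : ∀ u ∈ S, ∀ v ∈ S, PixelLinked α S u v) (hd : ∀ u ∈ S, u ∉ sitePerimeter α T) :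
    S ⊆ exteriorRegion α T ∨ ∀ u ∈ S, u ∉ exteriorRegion α T := by
  by_contra! h
  obtain ⟨h1, u, hu, huE⟩ := h
  exact h1 fun v hv => exteriorRegion_of_linked huE ((hS u hu v hv).mono hd)

theorem mem_exteriorRegion_of_injective {f : ℕ → ℤ × ℤ} (hf : Function.Injective f)
    (hadj : ∀ k, PixelAdj α (f k) (f (k + 1))) (hP : ∀ k, f k ∉ sitePerimeter α T) :
    f 0 ∈ exteriorRegion α T := by
  refine mem_exteriorRegion.2 ⟨hP 0, (Set.infinite_range_of_injective hf).mono ?_⟩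
  rintro _ ⟨k, rfl⟩
  induction k with
  | zero => exact .refl
  | succ k ih => exact Relation.ReflTransGen.tail ih ⟨hP k, hP (k + 1), hadj k⟩

/-- The site perimeter lies within one step of `T`. From a pixel outside a box one unit larger than
one containing `T`, the ray pointing away from the box is an infinite white path. -/
theorem finite_compl_exteriorRegion (hT : T.Finite) : (exteriorRegion α T)ᶜ.Finite := by
  obtain ⟨N, hN⟩ : ∃ N : ℤ, ∀ t ∈ T, |t.1| ≤ N ∧ |t.2| ≤ N := by
    obtain ⟨N, hN⟩ := (hT.image fun t : ℤ × ℤ => max |t.1| |t.2|).bddAbove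
    exact ⟨N, fun t ht => max_le_iff.1 (hN ⟨t, ht, rfl⟩)⟩
  have hP : ∀ z : ℤ × ℤ, N + 1 < |z.1| ∨ N + 1 < |z.2| → z ∉ sitePerimeter α T := by
    rintro z hz ⟨_, t, ht, hzt⟩
    have h1 := hN t ht
    have h2 := hzt.to_eight
    simp only [PixelAdj, pixelDist] at h2
    grind
  refine ((Set.finite_Icc (-(N + 1)) (N + 1)).prod
    (Set.finite_Icc (-(N + 1)) (N + 1))).subset fun z hz => ?_
  by_contra hcon
  apply hz
  have key : ∀ d : ℤ × ℤ, PixelAdj .four 0 d →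
      (∀ k : ℕ, N + 1 < |z.1 + k * d.1| ∨ N + 1 < |z.2 + k * d.2|) →
      z ∈ exteriorRegion α T := by
    intro d hd hk
    have := mem_exteriorRegion_of_injective (α := α) (T := T)
      (f := fun k : ℕ => (z.1 + k * d.1, z.2 + k * d.2)) ?_ ?_ fun k => hP _ (hk k)
    · simpa using this
    · intro a b hab
      simp only [Prod.mk.injEq, add_right_inj, mul_eq_mul_right_iff, Nat.cast_inj] at hab
      have := hd.ne
      rcases hab with ⟨h | h, h' | h'⟩ <;>
        first | assumption | exact absurd (Prod.ext h.symm h'.symm) this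
    · intro k
      apply PixelAdj.of_four
      simp only [PixelAdj, pixelDist, Prod.fst_zero, Prod.snd_zero, zero_sub, abs_neg] at hd ⊢
      push_cast
      have h1 : z.1 + k * d.1 - (z.1 + (k + 1) * d.1) = -d.1 := by ring
      have h2 : z.2 + k * d.2 - (z.2 + (k + 1) * d.2) = -d.2 := by ring
      rw [h1, h2, abs_neg, abs_neg, hd]
  have hcases : N + 1 < z.1 ∨ z.1 < -(N + 1) ∨ N + 1 < z.2 ∨ z.2 < -(N + 1) := by
    simp only [Set.mem_prod, Set.mem_Icc] at hcon
    omega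
  rcases hcases with h | h | h | h
  · refine key (1, 0) (by simp [PixelAdj, pixelDist]) fun k => Or.inl ?_
    simp only [mul_one]
    exact lt_of_lt_of_le (by omega) (le_abs_self _)
  · refine key (-1, 0) (by simp [PixelAdj, pixelDist]) fun k => Or.inl ?_
    simp only [mul_neg, mul_one]
    exact lt_of_lt_of_le (by omega) (neg_le_abs _)
  · refine key (0, 1) (by simp [PixelAdj, pixelDist]) fun k => Or.inr ?_
    simp only [mul_one]
    exact lt_of_lt_of_le (by omega) (le_abs_self _)
  · refine key (0, -1) (by simp [PixelAdj, pixelDist]) fun k => Or.inr ?_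
    simp only [mul_neg, mul_one]
    exact lt_of_lt_of_le (by omega) (neg_le_abs _)

end Exterior

/-! ### Labels and their bilinear interpolation. -/

section Label

variable {α : Connectivity} {T : Set (ℤ × ℤ)} {u v z : ℤ × ℤ}

open Classical in
/-- The label of a pixel relative to `T`: `-1` in the exterior region, `0` on the exterior site
perimeter, and `1` at the enclosed pixels. -/
noncomputable def pixelLabel (α : Connectivity) (T : Set (ℤ × ℤ)) (z : ℤ × ℤ) : ℝ :=
  if z ∈ exteriorRegion α T then -1 else if z ∈ exteriorSitePerimeter α T then 0 else 1

theorem pixelLabel_cases (α : Connectivity) (T : Set (ℤ × ℤ)) (z : ℤ × ℤ) :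
    pixelLabel α T z = -1 ∨ pixelLabel α T z = 0 ∨ pixelLabel α T z = 1 := by
  unfold pixelLabel
  split_ifs <;> simp

theorem pixelLabel_eq_neg_one : pixelLabel α T z = -1 ↔ z ∈ exteriorRegion α T := by
  unfold pixelLabel
  split_ifs <;> norm_num [*]

theorem pixelLabel_eq_zero : pixelLabel α T z = 0 ↔ z ∈ exteriorSitePerimeter α T := by
  unfold pixelLabel
  split_ifs with h1 h2
  · simp only [neg_eq_zero, one_ne_zero, false_iff]
    exact fun h => (mem_exteriorRegion.1 h1).1 h.1
  · simp [h2]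
  · simp [h2]

theorem pixelLabel_eq_one :
    pixelLabel α T z = 1 ↔ z ∉ exteriorRegion α T ∧ z ∉ exteriorSitePerimeter α T := by
  unfold pixelLabel
  split_ifs <;> norm_num [*]

theorem neg_one_le_pixelLabel : -1 ≤ pixelLabel α T z := by
  rcases pixelLabel_cases α T z with h | h | h <;> norm_num [h]

theorem pixelLabel_nonneg (h : z ∉ exteriorRegion α T) : 0 ≤ pixelLabel α T z := by
  have := mt pixelLabel_eq_neg_one.1 h
  rcases pixelLabel_cases α T z with h | h | h
  · contradiction
  · exact h.ge
  · norm_num [h]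

/-- A neighbor of the exterior region is white, hence in the same infinite component, or it is a
perimeter pixel and then an exterior one by definition. -/
theorem pixelLabel_nonpos_of_adj (hu : u ∈ exteriorRegion α T) (huv : PixelAdj α u v) :
    pixelLabel α T v ≤ 0 := by
  by_cases hv : v ∈ exteriorRegion α T
  · rw [pixelLabel_eq_neg_one.2 hv]
    norm_num
  · refine (pixelLabel_eq_zero.2 ⟨?_, u, hu, huv.symm⟩).le
    by_contra h
    exact hv (exteriorRegion_of_adj hu huv h)

theorem pixelLabel_eq_one_of_mem (hT : T.Finite) (hz : z ∈ T) : pixelLabel α T z = 1 :=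
  pixelLabel_eq_one.2 ⟨not_mem_exteriorRegion_of_mem hT hz, fun h => h.1.1 hz⟩

theorem pixelLabel_nonneg_of_adj_mem (hT : T.Finite) (hu : u ∈ T) (huv : PixelAdj α u v) :
    0 ≤ pixelLabel α T v := by
  apply pixelLabel_nonneg
  by_cases hv : v ∈ T
  · exact not_mem_exteriorRegion_of_mem hT hv
  · exact fun h => (mem_exteriorRegion.1 h).1 ⟨hv, u, hu, huv.symm⟩

/-- The labels at the ends of an `α`-edge are never opposite. -/
theorem pixelLabel_adj (huv : PixelAdj α u v) :
    ¬(pixelLabel α T u = -1 ∧ pixelLabel α T v = 1) := by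
  rintro ⟨h1, h2⟩
  have := pixelLabel_nonpos_of_adj (pixelLabel_eq_neg_one.1 h1) huv
  linarith

/-- The tent function supported on `[-1, 1]`. -/
noncomputable def tent (a : ℝ) : ℝ := max 0 (1 - |a|)

theorem continuous_tent : Continuous tent := by
  unfold tent
  fun_prop

theorem tent_eq_zero {a : ℝ} (h : 1 ≤ |a|) : tent a = 0 :=
  max_eq_left (by linarith)

theorem tent_of_mem {a : ℝ} (h0 : 0 ≤ a) (h1 : a ≤ 1) : tent a = 1 - a := by
  rw [tent, abs_of_nonneg h0, max_eq_right (by linarith)]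

theorem tent_of_neg_mem {a : ℝ} (h0 : -1 ≤ a) (h1 : a ≤ 0) : tent a = 1 + a := by
  rw [tent, abs_of_nonpos h1, max_eq_right (by linarith)]
  ring

/-- The bilinear interpolation of the labels on the unit squares of the lattice. -/
noncomputable def labelInterp (α : Connectivity) (T : Set (ℤ × ℤ)) (x : ℝ × ℝ) : ℝ :=
  -1 + ∑ᶠ z : ℤ × ℤ, (pixelLabel α T z + 1) * (tent (x.1 - z.1) * tent (x.2 - z.2))

/-- The shift of the labels by 1 makes the terms vanish on the exterior region, which leaves a
finite sum. -/
theorem continuous_labelInterp (hT : T.Finite) : Continuous (labelInterp α T) := by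
  have h : ∀ x, labelInterp α T x = -1 + ∑ z ∈ (finite_compl_exteriorRegion (α := α) hT).toFinset,
      (pixelLabel α T z + 1) * (tent (x.1 - z.1) * tent (x.2 - z.2)) := by
    intro x
    rw [labelInterp, finsum_eq_sum_of_support_subset]
    intro z hz
    simp only [Set.Finite.coe_toFinset, Set.mem_compl_iff]
    intro hzE
    apply hz
    simp [pixelLabel_eq_neg_one.2 hzE]
  rw [funext h]
  have := continuous_tent
  fun_prop

theorem labelInterp_apply (i j : ℤ) {s t : ℝ} (hs0 : 0 ≤ s) (hs1 : s ≤ 1) (ht0 : 0 ≤ t)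
    (ht1 : t ≤ 1) :
    labelInterp α T (i + s, j + t) =
      (1 - s) * (1 - t) * pixelLabel α T (i, j) + s * (1 - t) * pixelLabel α T (i + 1, j) +
        (1 - s) * t * pixelLabel α T (i, j + 1) + s * t * pixelLabel α T (i + 1, j + 1) := by
  have far : ∀ (a k : ℤ) (r : ℝ), 0 ≤ r → r ≤ 1 → k ≠ a → k ≠ a + 1 →
      tent (a + r - k) = 0 := by
    intro a k r h0 h1 h2 h3
    apply tent_eq_zero
    rcases lt_or_gt_of_ne h2 with h | h
    · have : (k : ℝ) + 1 ≤ a := by exact_mod_cast h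
      exact le_trans (by linarith) (le_abs_self _)
    · have : (a : ℝ) + 2 ≤ k := by exact_mod_cast (by omega : a + 2 ≤ k)
      exact le_trans (by linarith) (neg_le_abs _)
  have near : ∀ (a : ℤ) (r : ℝ), 0 ≤ r → r ≤ 1 →
      tent (a + r - a) = 1 - r ∧ tent (a + r - (a + 1 : ℤ)) = r := by
    intro a r h0 h1
    constructor
    · rw [add_sub_cancel_left, tent_of_mem h0 h1]
    · push_cast
      rw [tent_of_neg_mem (by linarith) (by linarith)]
      ring
  rw [labelInterp, finsum_eq_sum_of_support_subset _
    (s := ({i, i + 1} : Finset ℤ) ×ˢ ({j, j + 1} : Finset ℤ))]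
  · rw [Finset.sum_product, Finset.sum_pair (by simp), Finset.sum_pair (by simp),
      Finset.sum_pair (by simp)]
    simp only [near i s hs0 hs1, near j t ht0 ht1]
    ring
  · intro z hz
    simp only [Finset.coe_product, Finset.coe_insert, Finset.coe_singleton, Set.mem_prod,
      Set.mem_insert_iff, Set.mem_singleton_iff]
    by_contra hcon
    apply hz
    rw [not_and_or, not_or, not_or] at hcon
    rcases hcon with h | h
    · simp only [far i z.1 s hs0 hs1 h.1 h.2, zero_mul, mul_zero]
    · simp only [far j z.2 t ht0 ht1 h.1 h.2, mul_zero]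

theorem labelInterp_toPlane (z : ℤ × ℤ) : labelInterp α T (toPlane z) = pixelLabel α T z := by
  have := labelInterp_apply (α := α) (T := T) z.1 z.2 le_rfl zero_le_one le_rfl zero_le_one
  simpa [toPlane] using this

/-- Every point of the plane lies in a half-open unit square of the lattice. -/
theorem exists_lattice_coords (x : ℝ × ℝ) : ∃ (i j : ℤ) (s t : ℝ), 0 ≤ s ∧ s < 1 ∧ 0 ≤ t ∧ t < 1 ∧
    x = (i + s, j + t) :=
  ⟨⌊x.1⌋, ⌊x.2⌋, Int.fract x.1, Int.fract x.2, Int.fract_nonneg _, Int.fract_lt_one _,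
    Int.fract_nonneg _, Int.fract_lt_one _, by simp⟩

end Label

theorem mem_connectedComponentIn_of_segment {E : Type*} [AddCommGroup E] [Module ℝ E]
    [TopologicalSpace E] [IsTopologicalAddGroup E] [ContinuousSMul ℝ E] {F : Set E} {x y z : E}
    (hy : y ∈ connectedComponentIn F x) (hyz : segment ℝ y z ⊆ F) :
    z ∈ connectedComponentIn F x := by
  rw [connectedComponentIn_eq hy]
  exact (convex_segment y z).isPreconnected.subset_connectedComponentIn
    (left_mem_segment ℝ y z) hyz (right_mem_segment ℝ y z)

/-! ### Winding angles of closed curves and triangles. -/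

section Winding

open Complex

/-- Seen from the points off `K`, the direction of `v` is obtained from the direction of `u` by
rotating by an angle that depends continuously on the point. -/
def HasAngleLift (K : Set ℂ) (u v : ℂ) (b : ℂ → ℝ) : Prop :=
  ContinuousOn b Kᶜ ∧ ∀ q ∉ K, ∃ r : ℝ, 0 < r ∧ v - q = r * exp (b q * I) * (u - q)

theorem HasAngleLift.trans {K : Set ℂ} {u v w : ℂ} {b b' : ℂ → ℝ} (h : HasAngleLift K u v b)
    (h' : HasAngleLift K v w b') : HasAngleLift K u w (b + b') := by
  refine ⟨h.1.add h'.1, fun q hq => ?_⟩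
  obtain ⟨r, hr, e⟩ := h.2 q hq
  obtain ⟨r', hr', e'⟩ := h'.2 q hq
  refine ⟨r * r', mul_pos hr hr', ?_⟩
  rw [e', e]
  simp only [Pi.add_apply, ofReal_add, ofReal_mul, add_mul, exp_add]
  ring

theorem div_sub_mem_slitPlane {u v q : ℂ} (hq : q ∉ segment ℝ u v) :
    (v - q) / (u - q) ∈ slitPlane := by
  have hu : u - q ≠ 0 := by
    intro h
    rw [sub_eq_zero] at h
    exact hq (h ▸ left_mem_segment ℝ u v)
  have hv : v - q ≠ 0 := by
    intro h
    rw [sub_eq_zero] at h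
    exact hq (h ▸ right_mem_segment ℝ u v)
  by_contra hcon
  set w := (v - q) / (u - q) with hw
  have hvq : v - q = w * (u - q) := (div_mul_cancel₀ _ hu).symm
  rw [mem_slitPlane_iff, not_or, not_lt, not_not] at hcon
  have hwr : w = (w.re : ℂ) := by
    apply Complex.ext <;> simp [hcon.2]
  apply hq
  have h1 : (0 : ℝ) < 1 - w.re := by linarith [hcon.1]
  -- The weights come from solving `v - q = w * (u - q)` for `q` with `w` real and nonpositive.
  refine ⟨-w.re / (1 - w.re), 1 / (1 - w.re), div_nonneg (by linarith [hcon.1]) h1.le,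
    by positivity, by field_simp; ring, ?_⟩
  have h2 : (1 - (w.re : ℂ)) ≠ 0 := by
    have : ((1 - w.re : ℝ) : ℂ) ≠ 0 := ofReal_ne_zero.2 h1.ne'
    simpa using this
  simp only [real_smul, ofReal_div, ofReal_neg, ofReal_sub, ofReal_one]
  rw [hwr] at hvq
  field_simp
  linear_combination hvq

theorem hasAngleLift_segment {K : Set ℂ} {u v : ℂ} (h : segment ℝ u v ⊆ K) :
    HasAngleLift K u v fun q => arg ((v - q) / (u - q)) := by
  have hu : ∀ q ∉ K, u - q ≠ 0 := fun q hq h0 =>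
    hq (h (sub_eq_zero.1 h0 ▸ left_mem_segment ℝ u v))
  refine ⟨?_, fun q hq => ?_⟩
  · intro q hq
    apply ContinuousAt.continuousWithinAt
    have h1 : ContinuousAt (fun q => (v - q) / (u - q)) q :=
      (continuousAt_const.sub continuousAt_id).div (continuousAt_const.sub continuousAt_id) (hu q hq)
    exact ContinuousAt.comp (f := fun q => (v - q) / (u - q)) (g := arg)
      (continuousAt_arg (div_sub_mem_slitPlane fun hs => hq (h hs))) h1
  · have hs := div_sub_mem_slitPlane fun hs => hq (h hs)
    refine ⟨‖(v - q) / (u - q)‖, norm_pos_iff.2 (slitPlane_ne_zero hs), ?_⟩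
    rw [norm_mul_exp_arg_mul_I, div_mul_cancel₀ _ (hu q hq)]

/-- A nonconstant `f` would also take a half-integer multiple of 2π, by the intermediate value
theorem. -/
theorem eqOn_of_continuousOn_of_two_pi_int {X : Type*} [TopologicalSpace X] {M : Set X} {f : X → ℝ}
    (hM : IsPreconnected M) (hf : ContinuousOn f M)
    (hint : ∀ x ∈ M, ∃ k : ℤ, f x = k * (2 * Real.pi)) {x y : X} (hx : x ∈ M) (hy : y ∈ M) :
    f x = f y := by
  wlog hlt : f x < f y generalizing x y
  · rcases lt_trichotomy (f x) (f y) with h | h | h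
    · exact this hx hy h
    · exact h
    · exact (this hy hx h).symm
  obtain ⟨k, hk⟩ := hint x hx
  obtain ⟨l, hl⟩ := hint y hy
  have hpi := Real.pi_pos
  have hkl : k < l := by
    rw [hk, hl] at hlt
    exact_mod_cast lt_of_mul_lt_mul_right hlt (by positivity)
  have hkl' : (k : ℝ) + 1 ≤ l := by exact_mod_cast hkl
  obtain ⟨z, hz, hfz⟩ := hM.intermediate_value hx hy hf
    (show (k + 1 / 2 : ℝ) * (2 * Real.pi) ∈ Set.Icc (f x) (f y) by
      rw [hk, hl]
      constructor <;> nlinarith)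
  obtain ⟨j, hj⟩ := hint z hz
  rw [hj] at hfz
  have : (j : ℝ) = k + 1 / 2 := mul_right_cancel₀ (by positivity) hfz
  have h2 : (2 * j : ℤ) = 2 * k + 1 := by
    have : (2 * j : ℝ) = 2 * k + 1 := by rw [this]; ring
    exact_mod_cast this
  omega

/-- The total angle of a closed curve is constant on a preconnected set avoiding the curve. -/
theorem closed_angle_eq {K₁ K₂ M : Set ℂ} {p₁ p₂ t : ℂ} {b₁ b₂ : ℂ → ℝ}
    (h₁ : HasAngleLift K₁ p₁ t b₁) (h₂ : HasAngleLift K₂ p₂ t b₂) (hM : IsPreconnected M)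
    (hM₁ : Disjoint M K₁) (hM₂ : Disjoint M K₂) (hM₁₂ : Disjoint M (segment ℝ p₁ p₂))
    {x y : ℂ} (hx : x ∈ M) (hy : y ∈ M) :
    arg ((p₂ - x) / (p₁ - x)) + b₂ x - b₁ x = arg ((p₂ - y) / (p₁ - y)) + b₂ y - b₁ y := by
  have h₁₂ := hasAngleLift_segment (subset_refl (segment ℝ p₁ p₂))
  refine eqOn_of_continuousOn_of_two_pi_int
    (f := fun x => arg ((p₂ - x) / (p₁ - x)) + b₂ x - b₁ x) hM ?_ (fun q hq => ?_) hx hy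
  · exact ((h₁₂.1.mono hM₁₂.subset_compl_right).add (h₂.1.mono hM₂.subset_compl_right)).sub
      (h₁.1.mono hM₁.subset_compl_right)
  · obtain ⟨r₁, hr₁, e₁⟩ := h₁.2 q (Set.disjoint_left.1 hM₁ hq)
    obtain ⟨r₂, hr₂, e₂⟩ := h₂.2 q (Set.disjoint_left.1 hM₂ hq)
    obtain ⟨r, hr, e⟩ := h₁₂.2 q (Set.disjoint_left.1 hM₁₂ hq)
    have hp : p₁ - q ≠ 0 := fun h0 =>
      Set.disjoint_left.1 hM₁₂ hq (sub_eq_zero.1 h0 ▸ left_mem_segment ℝ p₁ p₂)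
    set a := arg ((p₂ - q) / (p₁ - q))
    -- Comparing the two ways from `p₁` to `t`, directly and through `p₂`, shows that the total
    -- angle of the closed curve is a multiple of 2π.
    have key : (r₂ * r : ℝ) * exp ((a + b₂ q - b₁ q : ℝ) * I) = (r₁ : ℂ) := by
      have h3 : (r₂ : ℂ) * exp (b₂ q * I) * (r * exp (a * I)) = r₁ * exp (b₁ q * I) := by
        apply mul_right_cancel₀ hp
        rw [← e₁, e₂, e]
        ring
      push_cast
      rw [sub_mul, add_mul, exp_sub, exp_add]
      rw [mul_div_assoc', div_eq_iff (exp_ne_zero (b₁ q * I))]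
      linear_combination h3
    have hnorm : r₂ * r = r₁ := by
      have := congrArg norm key
      rwa [norm_mul, norm_exp_ofReal_mul_I, mul_one, norm_real, norm_real,
        Real.norm_of_nonneg (by positivity), Real.norm_of_nonneg hr₁.le] at this
    rw [hnorm] at key
    have hexp : exp ((a + b₂ q - b₁ q : ℝ) * I) = 1 :=
      mul_left_cancel₀ (ofReal_ne_zero.2 hr₁.ne') (by rw [key, mul_one])
    obtain ⟨k, hk⟩ := exp_eq_one_iff.1 hexp
    refine ⟨k, ?_⟩
    have : ((a + b₂ q - b₁ q : ℝ) : ℂ) = ((k * (2 * Real.pi) : ℝ) : ℂ) := by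
      apply mul_right_cancel₀ I_ne_zero
      rw [hk]
      push_cast
      ring
    exact_mod_cast this

/-- The angle swept by the boundary of the triangle `p 0, p 1, p 2` as seen from `q`. -/
noncomputable def triangleAngle (p : Fin 3 → ℂ) (q : ℂ) : ℝ :=
  arg ((p 1 - q) / (p 0 - q)) + arg ((p 2 - q) / (p 1 - q)) + arg ((p 0 - q) / (p 2 - q))

/-- If `t` is linked to the three corners of a triangle, and `c` is linked to `s` through each of
the corners without meeting the other links and the opposite side, then `s` and `c` see the triangle
under the same angle. -/
theorem triangleAngle_eq {p : Fin 3 → ℂ} {t s c : ℂ} {L M : Fin 3 → Set ℂ} {b : Fin 3 → ℂ → ℝ}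
    (hL : ∀ i, HasAngleLift (L i) (p i) t (b i)) (hM : ∀ k, IsPreconnected (M k))
    (hs : ∀ k, s ∈ M k) (hc : ∀ k, c ∈ M k) (hML : ∀ k i, i ≠ k → Disjoint (M k) (L i))
    (hMp : ∀ k i j, i ≠ k → j ≠ k → i ≠ j → Disjoint (M k) (segment ℝ (p i) (p j))) :
    triangleAngle p s = triangleAngle p c := by
  have key : ∀ i j k, i ≠ k → j ≠ k → i ≠ j → _ := fun i j k hik hjk hij =>
    closed_angle_eq (hL i) (hL j) (hM k) (hML k i hik) (hML k j hjk) (hMp k i j hik hjk hij)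
      (hs k) (hc k)
  -- Each side of the triangle is closed up through `t`; in the sum of the three equations the lifts
  -- `b` cancel.
  have h1 := key 0 1 2 (by decide) (by decide) (by decide)
  have h2 := key 1 2 0 (by decide) (by decide) (by decide)
  have h3 := key 2 0 1 (by decide) (by decide) (by decide)
  unfold triangleAngle
  linarith

theorem arg_div_of_re_pos {a b : ℂ} (ha : 0 < a.re) (hb : 0 < b.re) :
    arg (b / a) = arg b - arg a := by
  have ha' := abs_lt.1 (abs_arg_lt_pi_div_two_iff.2 (Or.inl ha))
  have hb' := abs_lt.1 (abs_arg_lt_pi_div_two_iff.2 (Or.inl hb))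
  have ha0 : a ≠ 0 := fun h => by simp [h] at ha
  have hb0 : b ≠ 0 := fun h => by simp [h] at hb
  have hinv : arg a⁻¹ = -arg a := by
    rw [arg_inv, if_neg]
    have := Real.pi_pos
    linarith
  rw [div_eq_mul_inv, (arg_mul_eq_add_arg_iff hb0 (inv_ne_zero ha0)).2, hinv]
  · ring
  · rw [hinv]
    constructor <;> linarith

/-- The angle vanishes at the points separated from the triangle by a line. -/
theorem triangleAngle_eq_zero {p : Fin 3 → ℂ} {q w : ℂ} (h : ∀ i, 0 < (w * (p i - q)).re) :
    triangleAngle p q = 0 := by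
  have hw : w ≠ 0 := fun h0 => by simpa [h0] using h 0
  -- Multiplication by `w` moves the three directions into the right half-plane, where the argument
  -- of a quotient is a difference of arguments; the sum then telescopes.
  have key : ∀ i j, arg ((p j - q) / (p i - q)) = arg (w * (p j - q)) - arg (w * (p i - q)) := by
    intro i j
    rw [← arg_div_of_re_pos (h i) (h j), mul_div_mul_left _ _ hw]
  rw [triangleAngle, key, key, key]
  ring

theorem triangleAngle_ne_zero_of_im_pos {p : Fin 3 → ℂ} {q : ℂ}
    (h : ∀ i, 0 < ((p (i + 1) - q) / (p i - q)).im) : triangleAngle p q ≠ 0 := by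
  have key : ∀ i, 0 < arg ((p (i + 1) - q) / (p i - q)) := by
    intro i
    refine lt_of_le_of_ne (arg_nonneg_iff.2 (h i).le) fun h0 => ?_
    exact (h i).ne' (arg_eq_zero_iff.1 h0.symm).2
  exact (add_pos (add_pos (key 0) (key 1)) (key 2)).ne'

theorem triangleAngle_ne_zero_of_im_neg {p : Fin 3 → ℂ} {q : ℂ}
    (h : ∀ i, ((p (i + 1) - q) / (p i - q)).im < 0) : triangleAngle p q ≠ 0 := by
  have key : ∀ i, arg ((p (i + 1) - q) / (p i - q)) < 0 := fun i => arg_neg_iff.2 (h i)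
  exact (add_neg (add_neg (key 0) (key 1)) (key 2)).ne

end Winding

/-! ### Planarity: no K_{3,3} drawn with lattice edges. -/

section Planarity

/-- The inclusion of `ℤ²` in the complex plane. -/
def toComplex (z : ℤ × ℤ) : ℂ := ⟨z.1, z.2⟩

theorem mem_segment_complex {x y z : ℂ} (h : z ∈ segment ℝ x y) :
    ∃ l : ℝ, 0 ≤ l ∧ l ≤ 1 ∧ z.re = x.re + l * (y.re - x.re) ∧ z.im = x.im + l * (y.im - x.im) := by
  obtain ⟨a, b, ha, hb, hab, rfl⟩ := h
  refine ⟨b, hb, by linarith, ?_, ?_⟩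
  · simp only [Complex.add_re, Complex.real_smul, Complex.re_ofReal_mul]
    rw [← eq_sub_iff_add_eq] at hab
    rw [hab]
    ring
  · simp only [Complex.add_im, Complex.real_smul, Complex.im_ofReal_mul]
    rw [← eq_sub_iff_add_eq] at hab
    rw [hab]
    ring

theorem PixelAdj.abs_sub_le {α : Connectivity} {u v : ℤ × ℤ} (h : PixelAdj α u v) :
    |v.1 - u.1| ≤ 1 ∧ |v.2 - u.2| ≤ 1 := by
  have := h.to_eight.symm
  simp only [PixelAdj, pixelDist] at this
  exact ⟨this ▸ le_max_left _ _, this ▸ le_max_right _ _⟩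

/-- Two `α`-edges that meet have a common endpoint or adjacent starting points. -/
theorem segment_inter {α : Connectivity} {u v u' v' : ℤ × ℤ} (h : PixelAdj α u v)
    (h' : PixelAdj α u' v') {x : ℂ} (hx : x ∈ segment ℝ (toComplex u) (toComplex v))
    (hx' : x ∈ segment ℝ (toComplex u') (toComplex v')) :
    u = u' ∨ v = v' ∨ PixelAdj α u u' := by
  obtain ⟨l, hl0, hl1, e1, e2⟩ := mem_segment_complex hx
  obtain ⟨l', hl0', hl1', e1', e2'⟩ := mem_segment_complex hx'
  simp only [toComplex] at e1 e2 e1' e2'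
  have k1 : ((u.1 - u'.1 : ℤ) : ℝ) = l' * ((v'.1 - u'.1 : ℤ) : ℝ) - l * ((v.1 - u.1 : ℤ) : ℝ) := by
    push_cast
    linarith
  have k2 : ((u.2 - u'.2 : ℤ) : ℝ) = l' * ((v'.2 - u'.2 : ℤ) : ℝ) - l * ((v.2 - u.2 : ℤ) : ℝ) := by
    push_cast
    linarith
  have habs : ∀ d d' : ℤ, |l' * (d' : ℝ) - l * (d : ℝ)| ≤ l' * |d'| + l * |d| := by
    intro d d'
    refine (abs_sub _ _).trans ?_
    rw [abs_mul, abs_mul, abs_of_nonneg hl0, abs_of_nonneg hl0']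
    push_cast
    rfl
  have m1 := habs (v.1 - u.1) (v'.1 - u'.1)
  have m2 := habs (v.2 - u.2) (v'.2 - u'.2)
  rw [← k1, ← Int.cast_abs] at m1
  rw [← k2, ← Int.cast_abs] at m2
  -- The common point is at `d_α`-distance `l` from `u` and `l'` from `u'`, so the triangle
  -- inequality applies. Distance 2 forces `l = l' = 1`, that is, a common end.
  have hdist : (pixelDist α u u' : ℝ) ≤ l' + l := by
    have a1 := h.symm
    have a2 := h'.symm
    cases α
    · simp only [PixelAdj, pixelDist] at a1 a2 ⊢
      have a1' : ((|v.1 - u.1| : ℤ) : ℝ) + ((|v.2 - u.2| : ℤ) : ℝ) = 1 := by exact_mod_cast a1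
      have a2' : ((|v'.1 - u'.1| : ℤ) : ℝ) + ((|v'.2 - u'.2| : ℤ) : ℝ) = 1 := by exact_mod_cast a2
      rw [Int.cast_add]
      nlinarith
    · simp only [pixelDist]
      have b := h.abs_sub_le
      have b' := h'.abs_sub_le
      have b1 : ((|v.1 - u.1| : ℤ) : ℝ) ≤ 1 := by exact_mod_cast b.1
      have b2 : ((|v.2 - u.2| : ℤ) : ℝ) ≤ 1 := by exact_mod_cast b.2
      have b1' : ((|v'.1 - u'.1| : ℤ) : ℝ) ≤ 1 := by exact_mod_cast b'.1
      have b2' : ((|v'.2 - u'.2| : ℤ) : ℝ) ≤ 1 := by exact_mod_cast b'.2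
      rw [Int.cast_max]
      apply max_le <;> nlinarith
  have hpos : 0 ≤ pixelDist α u u' := by
    cases α <;> simp only [pixelDist] <;> positivity
  have hle : pixelDist α u u' ≤ 2 := by
    have : (pixelDist α u u' : ℝ) ≤ 2 := by linarith
    exact_mod_cast this
  obtain h0 | h1 | h2 : pixelDist α u u' = 0 ∨ pixelDist α u u' = 1 ∨ pixelDist α u u' = 2 := by
    omega
  · left
    cases α <;> simp only [pixelDist] at h0 <;> apply Prod.ext <;> grind
  · exact Or.inr (Or.inr h1)
  · right
    left
    rw [h2] at hdist
    push_cast at hdist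
    have hl : l = 1 := by linarith
    have hl' : l' = 1 := by linarith
    subst hl hl'
    apply Prod.ext
    · have : (v.1 : ℝ) = v'.1 := by linarith
      exact_mod_cast this
    · have : (v.2 : ℝ) = v'.2 := by linarith
      exact_mod_cast this

/-- The corners of the lattice triangle with right angle at `z` and legs of directions `e.1`,
`e.2`. -/
def corner (z e : ℤ × ℤ) : Fin 3 → ℤ × ℤ :=
  ![z, (z.1 + e.1, z.2), (z.1, z.2 + e.2)]

/-- The barycentric coordinates of the lattice triangle `corner z e`. -/
def bary (z e : ℤ × ℤ) : Fin 3 → ℂ → ℝ :=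
  ![fun x => 1 - e.1 * (x.re - z.1) - e.2 * (x.im - z.2), fun x => e.1 * (x.re - z.1),
    fun x => e.2 * (x.im - z.2)]

variable {z e : ℤ × ℤ}

theorem bary_segment {x y w : ℂ} (h : w ∈ segment ℝ x y) :
    ∃ l : ℝ, 0 ≤ l ∧ l ≤ 1 ∧ ∀ k, bary z e k w = (1 - l) * bary z e k x + l * bary z e k y := by
  obtain ⟨l, h0, h1, e1, e2⟩ := mem_segment_complex h
  refine ⟨l, h0, h1, fun k => ?_⟩
  fin_cases k <;> simp [bary, e1, e2] <;> ring

/-- The centroid of the lattice triangle `corner z e`. -/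
noncomputable def centroid (z e : ℤ × ℤ) : ℂ := ⟨z.1 + e.1 / 3, z.2 + e.2 / 3⟩

theorem sq_eq_one_of_unit {a : ℤ} (h : a = 1 ∨ a = -1) : (a : ℝ) * a = 1 := by
  rcases h with rfl | rfl <;> norm_num

theorem bary_centroid (he₁ : e.1 = 1 ∨ e.1 = -1) (he₂ : e.2 = 1 ∨ e.2 = -1) (k : Fin 3) :
    bary z e k (centroid z e) = 1 / 3 := by
  have h1 := sq_eq_one_of_unit he₁
  have h2 := sq_eq_one_of_unit he₂
  fin_cases k <;> simp [bary, centroid] <;> linarith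

theorem bary_corner (he₁ : e.1 = 1 ∨ e.1 = -1) (he₂ : e.2 = 1 ∨ e.2 = -1) (k i : Fin 3) :
    bary z e k (toComplex (corner z e i)) = if i = k then 1 else 0 := by
  have h1 := sq_eq_one_of_unit he₁
  have h2 := sq_eq_one_of_unit he₂
  fin_cases k <;> fin_cases i <;> simp [bary, corner, toComplex] <;> linarith

/-- An `α`-edge starting off the triangle meets it at most in a corner, its endpoint. -/
theorem edge_inter_triangle {α : Connectivity} (he₁ : e.1 = 1 ∨ e.1 = -1)
    (he₂ : e.2 = 1 ∨ e.2 = -1) {u v : ℤ × ℤ} (huv : PixelAdj α u v)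
    (hu : ∀ i, u ≠ corner z e i) (hu' : α = .eight → u ≠ (z.1 + e.1, z.2 + e.2)) {x : ℂ}
    (hx : x ∈ segment ℝ (toComplex u) (toComplex v)) (hpos : ∀ k, 0 ≤ bary z e k x) :
    ∃ i, v = corner z e i ∧ x = toComplex v := by
  obtain ⟨l, hl0, hl1, e1, e2⟩ := mem_segment_complex hx
  simp only [toComplex] at e1 e2
  obtain ⟨d1, d2⟩ := huv.abs_sub_le
  have p0 := hpos 0
  have p1 := hpos 1
  have p2 := hpos 2
  have n0 := hu 0
  have n1 := hu 1
  have n2 := hu 2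
  simp only [bary, corner, Matrix.cons_val_zero, Matrix.cons_val_one, Matrix.cons_val]
    at p0 p1 p2 n0 n1 n2
  -- In the frame of the triangle, `u` has coordinates `(A, B)`, the edge has direction `(a, b)`,
  -- and the triangle is given by nonnegative coordinates of sum at most 1.
  obtain ⟨A, hA⟩ : ∃ A : ℤ, A = e.1 * (u.1 - z.1) := ⟨_, rfl⟩
  obtain ⟨B, hB⟩ : ∃ B : ℤ, B = e.2 * (u.2 - z.2) := ⟨_, rfl⟩
  obtain ⟨a, ha⟩ : ∃ a : ℤ, a = e.1 * (v.1 - u.1) := ⟨_, rfl⟩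
  obtain ⟨b, hb⟩ : ∃ b : ℤ, b = e.2 * (v.2 - u.2) := ⟨_, rfl⟩
  have hx1 : (e.1 : ℝ) * (x.re - z.1) = A + l * a := by
    rw [hA, ha, e1]
    push_cast
    ring
  have hx2 : (e.2 : ℝ) * (x.im - z.2) = B + l * b := by
    rw [hB, hb, e2]
    push_cast
    ring
  rw [hx1] at p1
  rw [hx2] at p2
  rw [hx1, hx2] at p0
  have ha1 : |a| ≤ 1 := by
    rcases he₁ with h | h <;> rw [ha, h] <;> grind
  have hb1 : |b| ≤ 1 := by
    rcases he₂ with h | h <;> rw [hb, h] <;> grind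
  have hu1 : u.1 = z.1 + e.1 * A := by
    rcases he₁ with h | h <;> rw [hA, h] <;> ring
  have hu2 : u.2 = z.2 + e.2 * B := by
    rcases he₂ with h | h <;> rw [hB, h] <;> ring
  have hv1 : v.1 = z.1 + e.1 * (A + a) := by
    rcases he₁ with h | h <;> rw [hA, ha, h] <;> ring
  have hv2 : v.2 = z.2 + e.2 * (B + b) := by
    rcases he₂ with h | h <;> rw [hB, hb, h] <;> ring
  have c0 : ¬(A = 0 ∧ B = 0) := by
    rintro ⟨h, h'⟩
    exact n0 (Prod.ext (by simp [hu1, h]) (by simp [hu2, h']))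
  have c1 : ¬(A = 1 ∧ B = 0) := by
    rintro ⟨h, h'⟩
    exact n1 (Prod.ext (by simp [hu1, h]) (by simp [hu2, h']))
  have c2 : ¬(A = 0 ∧ B = 1) := by
    rintro ⟨h, h'⟩
    exact n2 (Prod.ext (by simp [hu1, h]) (by simp [hu2, h']))
  have haR : |(a : ℝ)| ≤ 1 := by exact_mod_cast ha1
  have hbR : |(b : ℝ)| ≤ 1 := by exact_mod_cast hb1
  rw [abs_le] at haR hbR
  -- Unless `A` and `B` are both 0 or 1, some coordinate must change by a full unit before the
  -- triangle is reached. As `u` is no corner, only `A = B = 1` remains; there a 4-step lowers `A +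
  -- B` by at most 1, and the case `α = .eight` is excluded by `hu'`.
  have hl : l = 1 := by
    apply le_antisymm hl1
    by_cases g1 : A ≤ -1
    · have : (A : ℝ) ≤ -1 := by exact_mod_cast g1
      nlinarith
    by_cases g2 : 2 ≤ A
    · have : (2 : ℝ) ≤ A := by exact_mod_cast g2
      nlinarith
    by_cases g3 : B ≤ -1
    · have : (B : ℝ) ≤ -1 := by exact_mod_cast g3
      nlinarith
    by_cases g4 : 2 ≤ B
    · have : (2 : ℝ) ≤ B := by exact_mod_cast g4
      nlinarith
    have hA1 : A = 1 := by omega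
    have hB1 : B = 1 := by omega
    cases α
    · have hab : |a| + |b| = 1 := by
        have h := huv.symm
        simp only [PixelAdj, pixelDist] at h
        rw [ha, hb, abs_mul, abs_mul, ← h]
        rcases he₁ with h | h <;> rcases he₂ with h' | h' <;> simp [h, h']
      have hab' : -(1 : ℝ) ≤ a + b := by
        have : -1 ≤ a + b := by grind
        exact_mod_cast this
      rw [hA1, hB1] at p0
      push_cast at p0
      nlinarith
    · exact absurd (Prod.ext (by simp [hu1, hA1]) (by simp [hu2, hB1])) (hu' rfl)
  subst hl
  have hxv : x = toComplex v := by
    apply Complex.ext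
    · simp only [toComplex]
      linarith
    · simp only [toComplex]
      linarith
  have q1 : 0 ≤ A + a := by
    have : (0 : ℝ) ≤ A + a := by linarith
    exact_mod_cast this
  have q2 : 0 ≤ B + b := by
    have : (0 : ℝ) ≤ B + b := by linarith
    exact_mod_cast this
  have q0 : (A + a) + (B + b) ≤ 1 := by
    have : ((A + a) + (B + b) : ℝ) ≤ 1 := by linarith
    exact_mod_cast this
  obtain ⟨h, h'⟩ | ⟨h, h'⟩ | ⟨h, h'⟩ : (A + a = 0 ∧ B + b = 0) ∨ (A + a = 1 ∧ B + b = 0) ∨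
      (A + a = 0 ∧ B + b = 1) := by omega
  · exact ⟨0, Prod.ext (by simp [hv1, h, corner]) (by simp [hv2, h', corner]), hxv⟩
  · exact ⟨1, Prod.ext (by simp [hv1, h, corner]) (by simp [hv2, h', corner]), hxv⟩
  · exact ⟨2, Prod.ext (by simp [hv1, h, corner]) (by simp [hv2, h', corner]), hxv⟩

/-- Seen from the centroid, all three sides turn in the same direction, given by the sign of `e.1 *
e.2`. -/
theorem triangleAngle_centroid_ne_zero (he₁ : e.1 = 1 ∨ e.1 = -1) (he₂ : e.2 = 1 ∨ e.2 = -1) :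
    triangleAngle (fun i => toComplex (corner z e i)) (centroid z e) ≠ 0 := by
  have key : ∀ i : Fin 3, ((toComplex (corner z e (i + 1)) - centroid z e) /
      (toComplex (corner z e i) - centroid z e)).im * (e.1 * e.2) > 0 := by
    intro i
    rcases he₁ with h | h <;> rcases he₂ with h' | h' <;> fin_cases i <;>
      simp [corner, toComplex, centroid, Complex.div_im, Complex.normSq_apply, h, h'] <;> norm_num
  rcases he₁ with h | h <;> rcases he₂ with h' | h' <;> rw [h, h'] at key
  · exact triangleAngle_ne_zero_of_im_pos fun i => by simpa using key i
  · exact triangleAngle_ne_zero_of_im_neg fun i => by simpa using key i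
  · exact triangleAngle_ne_zero_of_im_neg fun i => by simpa using key i
  · exact triangleAngle_ne_zero_of_im_pos fun i => by simpa using key i

/-- A lattice point that is not a corner is strictly separated from the triangle by a line parallel
to one of its sides; `w` encodes a normal of that line. -/
theorem triangleAngle_lattice_eq_zero (he₁ : e.1 = 1 ∨ e.1 = -1) (he₂ : e.2 = 1 ∨ e.2 = -1)
    {s : ℤ × ℤ} (hs : ∀ i, s ≠ corner z e i) :
    triangleAngle (fun i => toComplex (corner z e i)) (toComplex s) = 0 := by
  have n0 := hs 0
  have n1 := hs 1
  have n2 := hs 2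
  simp only [corner, Matrix.cons_val_zero, Matrix.cons_val_one, Matrix.cons_val] at n0 n1 n2
  obtain ⟨A, hA⟩ : ∃ A : ℤ, A = e.1 * (s.1 - z.1) := ⟨_, rfl⟩
  obtain ⟨B, hB⟩ : ∃ B : ℤ, B = e.2 * (s.2 - z.2) := ⟨_, rfl⟩
  have hs1 : s.1 = z.1 + e.1 * A := by
    rcases he₁ with h | h <;> rw [hA, h] <;> ring
  have hs2 : s.2 = z.2 + e.2 * B := by
    rcases he₂ with h | h <;> rw [hB, h] <;> ring
  have c0 : ¬(A = 0 ∧ B = 0) := by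
    rintro ⟨h, h'⟩
    exact n0 (Prod.ext (by simp [hs1, h]) (by simp [hs2, h']))
  have c1 : ¬(A = 1 ∧ B = 0) := by
    rintro ⟨h, h'⟩
    exact n1 (Prod.ext (by simp [hs1, h]) (by simp [hs2, h']))
  have c2 : ¬(A = 0 ∧ B = 1) := by
    rintro ⟨h, h'⟩
    exact n2 (Prod.ext (by simp [hs1, h]) (by simp [hs2, h']))
  have u1 := sq_eq_one_of_unit he₁
  have u2 := sq_eq_one_of_unit he₂
  by_cases g1 : A ≤ -1
  · have hR : (A : ℝ) ≤ -1 := by exact_mod_cast g1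
    refine triangleAngle_eq_zero (w := (e.1 : ℂ)) fun i => ?_
    fin_cases i <;> simp [corner, toComplex, hs1] <;> nlinarith
  by_cases g2 : B ≤ -1
  · have hR : (B : ℝ) ≤ -1 := by exact_mod_cast g2
    refine triangleAngle_eq_zero (w := -(e.2 : ℂ) * Complex.I) fun i => ?_
    fin_cases i <;> simp [corner, toComplex, hs2] <;> nlinarith
  · have g3 : 2 ≤ A + B := by omega
    have hR : (2 : ℝ) ≤ A + B := by exact_mod_cast g3
    refine triangleAngle_eq_zero (w := -(e.1 : ℂ) + (e.2 : ℂ) * Complex.I) fun i => ?_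
    have v1 : (e.1 : ℝ) * e.1 * A = A := by rw [u1, one_mul]
    have v2 : (e.2 : ℝ) * e.2 * B = B := by rw [u2, one_mul]
    fin_cases i <;> simp [corner, toComplex, hs1, hs2] <;> nlinarith

/-- The embedding of the `α`-edges that start in `S` and end in `S ∪ {p}`. -/
def edgeSet (α : Connectivity) (S : Set (ℤ × ℤ)) (p : ℤ × ℤ) : Set ℂ :=
  {x | ∃ u ∈ S, ∃ v, (v ∈ S ∨ v = p) ∧ PixelAdj α u v ∧ x ∈ segment ℝ (toComplex u) (toComplex v)}

theorem exists_hasAngleLift {α : Connectivity} {S : Set (ℤ × ℤ)} {p s t : ℤ × ℤ}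
    (hS : PixelLinked α S s t) (hs : s ∈ S) (hps : PixelAdj α p s) :
    ∃ b, HasAngleLift (edgeSet α S p) (toComplex p) (toComplex t) b := by
  induction hS with
  | refl =>
    refine ⟨_, hasAngleLift_segment fun x hx => ⟨s, hs, p, Or.inr rfl, hps.symm, ?_⟩⟩
    rwa [segment_symm]
  | tail _ hst ih =>
    obtain ⟨b, hb⟩ := ih
    exact ⟨_, hb.trans (hasAngleLift_segment fun x hx => ⟨_, hst.1, _, Or.inl hst.2.1, hst.2.2, hx⟩)⟩

/-- Two disjoint non-adjacent connected sets of pixels cannot both be adjacent to the three corners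
of a lattice triangle. -/
theorem not_three_common_neighbors {α : Connectivity} {S S' : Set (ℤ × ℤ)}
    (hS : ∀ u ∈ S, ∀ v ∈ S, PixelLinked α S u v) (hS' : ∀ u ∈ S', ∀ v ∈ S', PixelLinked α S' u v)
    (hSS' : ∀ u ∈ S, ∀ v ∈ S', u ≠ v ∧ ¬PixelAdj α u v)
    (he₁ : e.1 = 1 ∨ e.1 = -1) (he₂ : e.2 = 1 ∨ e.2 = -1)
    (hp : ∀ i, corner z e i ∉ S ∧ corner z e i ∉ S') (ht : ∀ i, ∃ t ∈ S, PixelAdj α (corner z e i) t)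
    (hs : ∀ i, ∃ s ∈ S', PixelAdj α (corner z e i) s)
    (hq : α = .eight → (z.1 + e.1, z.2 + e.2) ∉ S ∧ (z.1 + e.1, z.2 + e.2) ∉ S') : False := by
  choose t htS ht using ht
  choose s hsS hs using hs
  have hneS : ∀ u ∈ S, ∀ i, u ≠ corner z e i := fun u hu i h => (hp i).1 (h ▸ hu)
  have hneS' : ∀ u ∈ S', ∀ i, u ≠ corner z e i := fun u hu i h => (hp i).2 (h ▸ hu)
  choose b hb using fun i => exists_hasAngleLift (hS _ (htS i) _ (htS 0)) (htS i) (ht i)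
  set c := centroid z e with hc
  set p : Fin 3 → ℂ := fun i => toComplex (corner z e i) with hpdef
  -- `N k` contains a path from `S'` to the centroid through corner `k`. Together with the edges
  -- joining `S` to the corners, these sets would draw K_{3,3} with parts {`t 0`, `s 0`, `c`} and
  -- the corners.
  let N : Fin 3 → Set ℂ := fun k => edgeSet α S' (corner z e k) ∪ segment ℝ (p k) c
  have hcN : ∀ k, c ∈ N k := fun k => Or.inr (right_mem_segment ℝ _ _)
  have hcorner : ∀ i k, i ≠ k → bary z e k (p i) = 0 := fun i k hik => by
    rw [hpdef, bary_corner he₁ he₂, if_neg hik]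
  have hspoke : ∀ k x, x ∈ segment ℝ (p k) c → 0 < bary z e k x ∧ ∀ i, 0 ≤ bary z e i x := by
    intro k x hx
    obtain ⟨l, hl0, hl1, hl⟩ := bary_segment (z := z) (e := e) hx
    constructor
    · rw [hl, bary_centroid he₁ he₂, hpdef, bary_corner he₁ he₂, if_pos rfl]
      linarith
    · intro i
      rw [hl, bary_centroid he₁ he₂, hpdef, bary_corner he₁ he₂]
      split_ifs <;> linarith
  have hside : ∀ i j k x, i ≠ k → j ≠ k → x ∈ segment ℝ (p i) (p j) →
      bary z e k x = 0 ∧ ∀ i, 0 ≤ bary z e i x := by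
    intro i j k x hik hjk hx
    obtain ⟨l, hl0, hl1, hl⟩ := bary_segment (z := z) (e := e) hx
    constructor
    · rw [hl, hcorner i k hik, hcorner j k hjk]
      ring
    · intro m
      rw [hl, hpdef, bary_corner he₁ he₂, bary_corner he₁ he₂]
      split_ifs <;> linarith
  have hNL : ∀ k i, i ≠ k → Disjoint (N k) (edgeSet α S (corner z e i)) := by
    intro k i hik
    rw [Set.disjoint_left]
    rintro x hxN ⟨u, hu, v, hv, huv, hx⟩
    rcases hxN with ⟨u', hu', v', hv', huv', hx'⟩ | hx'
    · rcases segment_inter huv huv' hx hx' with h | h | h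
      · exact (hSS' u hu u' hu').1 h
      · rcases hv with hv | hv <;> rcases hv' with hv' | hv'
        · exact (hSS' v hv v' hv').1 h
        · exact hneS v hv k (h.trans hv')
        · exact hneS' v' hv' i (h.symm.trans hv)
        · have h1 := bary_corner (z := z) he₁ he₂ k i
          rw [← hv, h, hv', bary_corner he₁ he₂, if_pos rfl, if_neg hik] at h1
          exact one_ne_zero h1
      · exact (hSS' u hu u' hu').2 h
    · obtain ⟨m, hm, hxv⟩ := edge_inter_triangle he₁ he₂ huv (hneS u hu)
        (fun hα h => (hq hα).1 (h ▸ hu)) hx (hspoke k x hx').2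
      rcases hv with hv | hv
      · exact hneS v hv m hm
      · have := (hspoke k x hx').1
        rw [hxv, hv, ← hcorner i k hik] at this
        exact lt_irrefl _ this
  have hNp : ∀ k i j, i ≠ k → j ≠ k → i ≠ j → Disjoint (N k) (segment ℝ (p i) (p j)) := by
    intro k i j hik hjk _
    rw [Set.disjoint_left]
    rintro x hxN hx
    obtain ⟨h0, hpos⟩ := hside i j k x hik hjk hx
    rcases hxN with ⟨u', hu', v', hv', huv', hx'⟩ | hx'
    · obtain ⟨m, hm, hxv⟩ := edge_inter_triangle he₁ he₂ huv' (hneS' u' hu')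
        (fun hα h => (hq hα).2 (h ▸ hu')) hx' hpos
      rcases hv' with hv | hv
      · exact hneS' v' hv m hm
      · rw [hxv, hv, bary_corner he₁ he₂, if_pos rfl] at h0
        exact one_ne_zero h0
    · exact (hspoke k x hx').1.ne' h0
  have hsM : ∀ k, toComplex (s 0) ∈ connectedComponentIn (N k) c := by
    intro k
    have h1 : p k ∈ connectedComponentIn (N k) c := by
      refine mem_connectedComponentIn_of_segment (mem_connectedComponentIn (hcN k)) ?_
      rw [segment_symm]
      exact Set.subset_union_right
    have h2 : toComplex (s k) ∈ connectedComponentIn (N k) c := by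
      refine mem_connectedComponentIn_of_segment h1 fun x hx => Or.inl ?_
      exact ⟨s k, hsS k, _, Or.inr rfl, (hs k).symm, by rwa [segment_symm]⟩
    refine (hS' _ (hsS k) _ (hsS 0)).induct (p := fun w => toComplex w ∈ connectedComponentIn (N k) c)
      h2 fun a b ha haS hbS hab => ?_
    exact mem_connectedComponentIn_of_segment ha fun x hx =>
      Or.inl ⟨a, haS, b, Or.inl hbS, hab, hx⟩
  have hfinal := triangleAngle_eq (p := p) (t := toComplex (t 0)) (s := toComplex (s 0)) (c := c)
    (L := fun i => edgeSet α S (corner z e i)) (M := fun k => connectedComponentIn (N k) c) (b := b)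
    hb (fun k => isPreconnected_connectedComponentIn) hsM
    (fun k => mem_connectedComponentIn (hcN k))
    (fun k i hik => (hNL k i hik).mono_left (connectedComponentIn_subset _ _))
    (fun k i j hik hjk hij => (hNp k i j hik hjk hij).mono_left (connectedComponentIn_subset _ _))
  rw [triangleAngle_lattice_eq_zero he₁ he₂ (hneS' _ (hsS 0))] at hfinal
  exact triangleAngle_centroid_ne_zero he₁ he₂ hfinal.symm

end Planarity

/-! ### Connectedness of the exterior region; forbidden zero labels. -/

section ExteriorConnected

variable {α : Connectivity} {T : Set (ℤ × ℤ)}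

theorem linked_of_forall_uIcc_fst {S : Set (ℤ × ℤ)} (a b j : ℤ)
    (h : ∀ i ∈ Set.uIcc a b, (i, j) ∈ S) : PixelLinked α S (a, j) (b, j) := by
  wlog hab : a ≤ b generalizing a b
  · exact (this b a (by rwa [Set.uIcc_comm]) (by omega)).symm
  rw [Set.uIcc_of_le hab] at h
  induction b, hab using Int.leInduction with
  | base => exact .refl
  | succ k hk ih =>
    refine (ih fun i hi => h i ⟨hi.1, by linarith [hi.2]⟩).tail
      ⟨h k ⟨hk, by omega⟩, h (k + 1) ⟨by omega, le_rfl⟩, PixelAdj.of_four ?_⟩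
    simp [PixelAdj, pixelDist]

theorem linked_of_forall_uIcc_snd {S : Set (ℤ × ℤ)} (a b i : ℤ)
    (h : ∀ j ∈ Set.uIcc a b, (i, j) ∈ S) : PixelLinked α S (i, a) (i, b) := by
  wlog hab : a ≤ b generalizing a b
  · exact (this b a (by rwa [Set.uIcc_comm]) (by omega)).symm
  rw [Set.uIcc_of_le hab] at h
  induction b, hab using Int.leInduction with
  | base => exact .refl
  | succ k hk ih =>
    refine (ih fun j hj => h j ⟨hj.1, by linarith [hj.2]⟩).tail
      ⟨h k ⟨hk, by omega⟩, h (k + 1) ⟨by omega, le_rfl⟩, PixelAdj.of_four ?_⟩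
    simp [PixelAdj, pixelDist]

/-- The complement of a box is connected. -/
theorem linked_compl_box {S : Set (ℤ × ℤ)} {N : ℤ}
    (hS : ∀ z : ℤ × ℤ, N < |z.1| ∨ N < |z.2| → z ∈ S) {z : ℤ × ℤ} (hz : N < |z.1| ∨ N < |z.2|) :
    PixelLinked α S z (N + 1, N + 1) := by
  have far : ∀ a : ℤ, N < a ∨ a < -N → N < |a| := by
    intro a ha
    rcases ha with h | h
    · exact h.trans_le (le_abs_self a)
    · exact (by omega : N < -a).trans_le (neg_le_abs a)
  have vert : ∀ a j j' : ℤ, N < |a| → PixelLinked α S (a, j) (a, j') := fun a j j' ha =>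
    linked_of_forall_uIcc_snd _ _ _ fun _ _ => hS _ (Or.inl ha)
  have horiz : ∀ a i i' : ℤ, N < |a| → PixelLinked α S (i, a) (i', a) := fun a i i' ha =>
    linked_of_forall_uIcc_fst _ _ _ fun _ _ => hS _ (Or.inr ha)
  obtain ⟨a, b⟩ := z
  have hN1 := far (N + 1) (by omega)
  rcases hz with h | h
  · exact (vert a b (N + 1) h).trans (horiz _ _ _ hN1)
  · exact (horiz b a (N + 1) h).trans (vert _ _ _ hN1)

/-- The exterior region of a finite set is connected. -/
theorem exteriorRegion_linked (hT : T.Finite) :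
    ∀ u ∈ exteriorRegion α T, ∀ v ∈ exteriorRegion α T, PixelLinked α (exteriorRegion α T) u v := by
  obtain ⟨N, hN⟩ : ∃ N : ℤ, ∀ z : ℤ × ℤ, N < |z.1| ∨ N < |z.2| →
      z ∈ exteriorRegion α T := by
    obtain ⟨N, hN⟩ := ((finite_compl_exteriorRegion (α := α) hT).image
      fun t : ℤ × ℤ => max |t.1| |t.2|).bddAbove
    refine ⟨N, fun z hz => ?_⟩
    by_contra hcon
    have := max_le_iff.1 (hN ⟨z, hcon, rfl⟩)
    omega
  suffices ∀ u ∈ exteriorRegion α T, PixelLinked α (exteriorRegion α T) u (N + 1, N + 1) from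
    fun u hu v hv => (this u hu).trans (this v hv).symm
  intro u hu
  obtain ⟨-, hinf⟩ := mem_exteriorRegion.1 hu
  -- An infinite component leaves the box, and the complement of the box is connected.
  obtain ⟨w, hw, hwN⟩ : ∃ w, PixelLinked α (sitePerimeter α T)ᶜ u w ∧ (N < |w.1| ∨ N < |w.2|) := by
    by_contra! hcon
    refine hinf (((Set.finite_Icc (-N) N).prod (Set.finite_Icc (-N) N)).subset fun w hw => ?_)
    obtain ⟨h1, h2⟩ := hcon w hw
    exact ⟨abs_le.1 h1, abs_le.1 h2⟩
  refine (hw.linked_component.mono ?_).trans (linked_compl_box hN hwN)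
  exact fun v hv => exteriorRegion_of_linked hu hv

/-- The labels of a connected set do not vanish on three corners of a unit square if `α = 4`, or on
all four corners if `α = 8`. -/
theorem not_label_eq_zero_of_corners (hT : T.Finite)
    (hTc : ∀ u ∈ T, ∀ v ∈ T, PixelLinked α T u v) (z e : ℤ × ℤ)
    (he₁ : e.1 = 1 ∨ e.1 = -1) (he₂ : e.2 = 1 ∨ e.2 = -1) (h₀ : pixelLabel α T z = 0)
    (h₁ : pixelLabel α T (z.1 + e.1, z.2) = 0) (h₂ : pixelLabel α T (z.1, z.2 + e.2) = 0)
    (h₃ : α = .eight → pixelLabel α T (z.1 + e.1, z.2 + e.2) = 0) : False := by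
  have hsep : ∀ p ∈ exteriorSitePerimeter α T, p ∉ T ∧ p ∉ exteriorRegion α T :=
    fun p hp => ⟨hp.1.1, fun h => (mem_exteriorRegion.1 h).1 hp.1⟩
  have hc : ∀ i, corner z e i ∈ exteriorSitePerimeter α T := by
    intro i
    fin_cases i
    · exact pixelLabel_eq_zero.1 h₀
    · exact pixelLabel_eq_zero.1 h₁
    · exact pixelLabel_eq_zero.1 h₂
  -- A pixel of label 0 is adjacent both to `T` and to the exterior region, two connected sets that
  -- are disjoint and not adjacent to each other.
  refine not_three_common_neighbors (z := z) (e := e) hTc (exteriorRegion_linked (α := α) hT) ?_ he₁ he₂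
    (fun i => hsep _ (hc i)) (fun i => (hc i).1.2) (fun i => (hc i).2)
    fun hα => hsep _ (pixelLabel_eq_zero.1 (h₃ hα))
  intro u hu v hv
  constructor
  · rintro rfl
    exact not_mem_exteriorRegion_of_mem hT hu hv
  · intro huv
    have h1 := pixelLabel_nonneg_of_adj_mem hT hu huv
    rw [pixelLabel_eq_neg_one.2 hv] at h1
    linarith

end ExteriorConnected

/-! ### The polygon inside the cells of the lattice. -/

section Region

variable {α : Connectivity} {T : Set (ℤ × ℤ)}

theorem int_add_eq_int {k m : ℤ} {r : ℝ} (h0 : 0 ≤ r) (h1 : r < 1) (h : (k : ℝ) + r = m) :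
    k = m ∧ r = 0 := by
  have hk : k = m := by
    have h2 : (k : ℝ) < m + 1 := by linarith
    have h3 : (m : ℝ) < k + 1 := by linarith
    norm_cast at h2 h3
    omega
  subst hk
  exact ⟨rfl, by linarith⟩

theorem coord_cases {u v i : ℤ} {l s : ℝ} (huv : |v - u| ≤ 1) (hl0 : 0 < l) (hl1 : l < 1)
    (hs0 : 0 ≤ s) (hs1 : s < 1) (h : (i : ℝ) + s = u + l * (v - u)) :
    (v = u ∧ i = u ∧ s = 0) ∨ (v = i + 1 ∧ u = i ∧ s = l) ∨ (u = i + 1 ∧ v = i ∧ s = 1 - l) := by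
  obtain h1 | h1 | h1 : v = u ∨ v = u + 1 ∨ v = u - 1 := by grind
  · left
    subst h1
    rw [sub_self, mul_zero, add_zero] at h
    have hi : i = v := by
      have h2 : (i : ℝ) < v + 1 := by linarith
      have h3 : (v : ℝ) < i + 1 := by linarith
      norm_cast at h2 h3
      omega
    subst hi
    exact ⟨rfl, rfl, by linarith⟩
  · right
    left
    subst h1
    push_cast at h
    have hi : u = i := by
      have h2 : (i : ℝ) < u + 1 := by linarith
      have h3 : (u : ℝ) < i + 1 := by linarith
      norm_cast at h2 h3
      omega
    subst hi
    exact ⟨rfl, rfl, by linarith⟩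
  · right
    right
    subst h1
    push_cast at h
    have hi : u = i + 1 := by
      have h2 : (i : ℝ) < u := by linarith
      have h3 : (u : ℝ) < i + 2 := by linarith
      norm_cast at h2 h3
      omega
    subst hi
    push_cast at h
    exact ⟨rfl, by ring, by linarith⟩

/-- The position of an edge between neighboring pixels in the cells of the lattice. -/
theorem edge_cases {u v : ℤ × ℤ} (huv : PixelAdj .eight u v) (p : ℤ × ℤ → Prop) (hu : p u)
    (hv : p v) {i j : ℤ} {s t : ℝ} (hs0 : 0 ≤ s) (hs1 : s < 1) (ht0 : 0 ≤ t) (ht1 : t < 1)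
    (hx : ((i + s, j + t) : ℝ × ℝ) ∈ segment ℝ (toPlane u) (toPlane v)) :
    (s = 0 ∧ t = 0 ∧ p (i, j)) ∨ (s = 0 ∧ 0 < t ∧ p (i, j) ∧ p (i, j + 1)) ∨
      (0 < s ∧ t = 0 ∧ p (i, j) ∧ p (i + 1, j)) ∨
      (0 < s ∧ 0 < t ∧ ¬PixelAdj .four u v ∧
        ((s = t ∧ p (i, j) ∧ p (i + 1, j + 1)) ∨ (s + t = 1 ∧ p (i + 1, j) ∧ p (i, j + 1)))) := by
  obtain ⟨a, l, ha, hl, hal, hx⟩ := hx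
  obtain rfl : a = 1 - l := by linarith
  have e1 : (i : ℝ) + s = u.1 + l * (v.1 - u.1) := by
    have := congrArg Prod.fst hx
    simp only [toPlane, Prod.smul_mk, Prod.mk_add_mk, smul_eq_mul] at this
    linarith
  have e2 : (j : ℝ) + t = u.2 + l * (v.2 - u.2) := by
    have := congrArg Prod.snd hx
    simp only [toPlane, Prod.smul_mk, Prod.mk_add_mk, smul_eq_mul] at this
    linarith
  have vertex : ∀ w : ℤ × ℤ, p w → (i : ℝ) + s = w.1 → (j : ℝ) + t = w.2 →
      s = 0 ∧ t = 0 ∧ p (i, j) := by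
    intro w hw h1 h2
    obtain ⟨rfl, h3⟩ := int_add_eq_int hs0 hs1 h1
    obtain ⟨rfl, h4⟩ := int_add_eq_int ht0 ht1 h2
    exact ⟨h3, h4, hw⟩
  rcases hl.eq_or_lt with rfl | hl0
  · exact Or.inl (vertex u hu (by linarith) (by linarith))
  rcases ha.eq_or_lt with ha | ha
  · obtain rfl : l = 1 := by linarith
    exact Or.inl (vertex v hv (by linarith) (by linarith))
  have hl1 : l < 1 := by linarith
  obtain ⟨d1, d2⟩ := huv.abs_sub_le
  obtain ⟨u1, u2⟩ := u
  obtain ⟨v1, v2⟩ := v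
  dsimp only at e1 e2 d1 d2
  rcases coord_cases d1 hl0 hl1 hs0 hs1 e1 with ⟨rfl, rfl, rfl⟩ | ⟨rfl, rfl, rfl⟩ | ⟨rfl, rfl, rfl⟩ <;>
    rcases coord_cases d2 hl0 hl1 ht0 ht1 e2 with ⟨rfl, rfl, h⟩ | ⟨rfl, rfl, h⟩ | ⟨rfl, rfl, h⟩
  · exact absurd rfl huv.ne
  · exact Or.inr (Or.inl ⟨rfl, by linarith, hu, hv⟩)
  · exact Or.inr (Or.inl ⟨rfl, by linarith, hv, hu⟩)
  · exact Or.inr (Or.inr (Or.inl ⟨hl0, h, hu, hv⟩))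
  · refine Or.inr (Or.inr (Or.inr ⟨hl0, by linarith, ?_, Or.inl ⟨h.symm, hu, hv⟩⟩))
    simp [PixelAdj, pixelDist]
  · refine Or.inr (Or.inr (Or.inr ⟨hl0, by linarith, ?_, Or.inr ⟨by linarith, hv, hu⟩⟩))
    simp [PixelAdj, pixelDist]
  · exact Or.inr (Or.inr (Or.inl ⟨by linarith, h, hv, hu⟩))
  · refine Or.inr (Or.inr (Or.inr ⟨by linarith, by linarith, ?_, Or.inr ⟨by linarith, hu, hv⟩⟩))
    simp [PixelAdj, pixelDist]
  · refine Or.inr (Or.inr (Or.inr ⟨by linarith, by linarith, ?_, Or.inl ⟨by linarith, hv, hu⟩⟩))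
    simp [PixelAdj, pixelDist]

theorem mem_boundaryPolygon_of_label {u v : ℤ × ℤ} (hu : pixelLabel α T u = 0)
    (hv : pixelLabel α T v = 0) (huv : PixelAdj α.dual u v) {x : ℝ × ℝ}
    (hx : x ∈ segment ℝ (toPlane u) (toPlane v)) : x ∈ boundaryPolygon α T := by
  rw [pixelLabel_eq_zero] at hu hv
  exact Or.inr ⟨u, hu, v, hv,
    Or.inr ⟨mem_black_charImage.2 hu.1, mem_black_charImage.2 hv.1, huv⟩, hx⟩

theorem toPlane_mem_boundaryPolygon {u : ℤ × ℤ} (hu : pixelLabel α T u = 0) :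
    toPlane u ∈ boundaryPolygon α T :=
  Or.inl ⟨u, pixelLabel_eq_zero.1 hu, rfl⟩

/-- The position of the boundary polygon in the cells of the lattice. -/
theorem boundaryPolygon_cases {i j : ℤ} {s t : ℝ} (hs0 : 0 ≤ s) (hs1 : s < 1) (ht0 : 0 ≤ t)
    (ht1 : t < 1) (hx : ((i + s, j + t) : ℝ × ℝ) ∈ boundaryPolygon α T) :
    (s = 0 ∧ t = 0 ∧ pixelLabel α T (i, j) = 0) ∨
      (s = 0 ∧ 0 < t ∧ pixelLabel α T (i, j) = 0 ∧ pixelLabel α T (i, j + 1) = 0) ∨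
      (0 < s ∧ t = 0 ∧ pixelLabel α T (i, j) = 0 ∧ pixelLabel α T (i + 1, j) = 0) ∨
      (0 < s ∧ 0 < t ∧ α = .four ∧
        ((s = t ∧ pixelLabel α T (i, j) = 0 ∧ pixelLabel α T (i + 1, j + 1) = 0) ∨
          (s + t = 1 ∧ pixelLabel α T (i + 1, j) = 0 ∧ pixelLabel α T (i, j + 1) = 0))) := by
  rcases hx with ⟨u, hu, hux⟩ | ⟨u, hu, v, hv, huv, hx⟩
  · left
    obtain ⟨rfl, h3⟩ := int_add_eq_int hs0 hs1 (congrArg Prod.fst hux).symm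
    obtain ⟨rfl, h4⟩ := int_add_eq_int ht0 ht1 (congrArg Prod.snd hux).symm
    exact ⟨h3, h4, pixelLabel_eq_zero.2 hu⟩
  · have hadj : PixelAdj α.dual u v := by
      rcases huv with h | h
      · exact absurd hu.1 (mem_white_charImage.1 h.1)
      · exact h.2.2
    rcases edge_cases hadj.to_eight (fun w => pixelLabel α T w = 0) (pixelLabel_eq_zero.2 hu)
      (pixelLabel_eq_zero.2 hv) hs0 hs1 ht0 ht1 hx with h | h | h | ⟨h1, h2, h3, h4⟩
    · exact Or.inl h
    · exact Or.inr (Or.inl h)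
    · exact Or.inr (Or.inr (Or.inl h))
    · refine Or.inr (Or.inr (Or.inr ⟨h1, h2, ?_, h4⟩))
      -- For `α = .eight` black pixels are joined by 4-edges, so the polygon has no diagonals.
      cases α
      · rfl
      · exact absurd hadj h3

/-- `x` lies in the open unit square with corner `z` and sides of directions `e.1`, `e.2`, at
distances `s`, `t` from the sides at `z`. -/
structure IsSquareFrame (x : ℝ × ℝ) (z e : ℤ × ℤ) (s t : ℝ) : Prop where
  unit_fst : e.1 = 1 ∨ e.1 = -1
  unit_snd : e.2 = 1 ∨ e.2 = -1
  s_pos : 0 < s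
  s_lt : s < 1
  t_pos : 0 < t
  t_lt : t < 1
  eq : x = (z.1 + e.1 * s, z.2 + e.2 * t)

/-- `x` lies on the open edge from `u` to `v`, at distance `l` from `u`. -/
structure IsEdgeFrame (x : ℝ × ℝ) (u v : ℤ × ℤ) (l : ℝ) : Prop where
  adj : PixelAdj .four u v
  l_pos : 0 < l
  l_lt : l < 1
  eq : x = (u.1 + l * (v.1 - u.1), u.2 + l * (v.2 - u.2))

theorem vertex_or_edge_or_square (x : ℝ × ℝ) : (∃ z, x = toPlane z) ∨
    (∃ u v l, IsEdgeFrame x u v l) ∨ ∃ z e s t, IsSquareFrame x z e s t := by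
  obtain ⟨i, j, s, t, hs0, hs1, ht0, ht1, rfl⟩ := exists_lattice_coords x
  rcases hs0.eq_or_lt with rfl | hs0 <;> rcases ht0.eq_or_lt with rfl | ht0
  · exact Or.inl ⟨(i, j), by simp [toPlane]⟩
  · exact Or.inr (Or.inl ⟨(i, j), (i, j + 1), t, by simp [PixelAdj, pixelDist], ht0, ht1, by simp⟩)
  · exact Or.inr (Or.inl ⟨(i, j), (i + 1, j), s, by simp [PixelAdj, pixelDist], hs0, hs1, by simp⟩)
  · exact Or.inr (Or.inr ⟨(i, j), (1, 1), s, t, Or.inl rfl, Or.inl rfl, hs0, hs1, ht0, ht1, by simp⟩)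

namespace IsEdgeFrame

variable {x : ℝ × ℝ} {u v : ℤ × ℤ} {l : ℝ}

theorem flip (h : IsEdgeFrame x u v l) : IsEdgeFrame x v u (1 - l) where
  adj := h.adj.symm
  l_pos := by linarith [h.l_lt]
  l_lt := by linarith [h.l_pos]
  eq := by
    rw [h.eq]
    ext <;> dsimp only <;> ring

theorem mem_segment (h : IsEdgeFrame x u v l) : x ∈ segment ℝ (toPlane u) (toPlane v) := by
  refine ⟨1 - l, l, by linarith [h.l_lt], h.l_pos.le, by ring, ?_⟩
  rw [h.eq]
  ext <;> simp only [toPlane, Prod.smul_mk, Prod.mk_add_mk, smul_eq_mul] <;> ring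

/-- Reduction to edges pointing right or up; reversing an edge replaces `l` by `1 - l`. -/
theorem induct {p : ℤ × ℤ → ℤ × ℤ → ℝ → Prop} (h : IsEdgeFrame x u v l)
    (hflip : ∀ u v l, p v u (1 - l) → p u v l)
    (h1 : ∀ i j : ℤ, x = (i + l, (j : ℝ)) → p (i, j) (i + 1, j) l)
    (h1' : ∀ i j : ℤ, x = (i + (1 - l), (j : ℝ)) → p (i, j) (i + 1, j) (1 - l))
    (h2 : ∀ i j : ℤ, x = ((i : ℝ), j + l) → p (i, j) (i, j + 1) l)
    (h2' : ∀ i j : ℤ, x = ((i : ℝ), j + (1 - l)) → p (i, j) (i, j + 1) (1 - l)) : p u v l := by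
  have hadj := h.adj
  have heq := h.eq
  obtain ⟨u1, u2⟩ := u
  obtain ⟨v1, v2⟩ := v
  simp only [PixelAdj, pixelDist] at hadj
  obtain ⟨h3, h4⟩ | ⟨h3, h4⟩ | ⟨h3, h4⟩ | ⟨h3, h4⟩ : (v1 = u1 + 1 ∧ v2 = u2) ∨
      (u1 = v1 + 1 ∧ v2 = u2) ∨ (v1 = u1 ∧ v2 = u2 + 1) ∨ (v1 = u1 ∧ u2 = v2 + 1) := by
    clear * - hadj
    grind
  · subst h3 h4
    exact h1 _ _ (by simp [heq])
  · subst h3 h4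
    refine hflip _ _ _ (h1' _ _ ?_)
    rw [heq]
    ext <;> push_cast <;> ring
  · subst h3 h4
    exact h2 _ _ (by simp [heq])
  · subst h3 h4
    refine hflip _ _ _ (h2' _ _ ?_)
    rw [heq]
    ext <;> push_cast <;> ring

theorem labelInterp_eq (h : IsEdgeFrame x u v l) :
    labelInterp α T x = (1 - l) * pixelLabel α T u + l * pixelLabel α T v := by
  have l0 := h.l_pos
  have l1 := h.l_lt
  have hor : ∀ (i j : ℤ) (s : ℝ), 0 ≤ s → s ≤ 1 → x = (i + s, (j : ℝ)) → labelInterp α T x =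
      (1 - s) * pixelLabel α T (i, j) + s * pixelLabel α T (i + 1, j) := by
    intro i j s hs0 hs1 hx
    have := labelInterp_apply (α := α) (T := T) i j hs0 hs1 le_rfl zero_le_one
    rw [add_zero] at this
    rw [hx, this]
    ring
  have ver : ∀ (i j : ℤ) (s : ℝ), 0 ≤ s → s ≤ 1 → x = ((i : ℝ), j + s) → labelInterp α T x =
      (1 - s) * pixelLabel α T (i, j) + s * pixelLabel α T (i, j + 1) := by
    intro i j s hs0 hs1 hx
    have := labelInterp_apply (α := α) (T := T) i j le_rfl zero_le_one hs0 hs1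
    rw [add_zero] at this
    rw [hx, this]
    ring
  refine h.induct (p := fun u v l => labelInterp α T x =
    (1 - l) * pixelLabel α T u + l * pixelLabel α T v) ?_ ?_ ?_ ?_ ?_
  · intro u v l h
    rw [h]
    ring
  · exact fun i j hx => hor i j l l0.le l1.le hx
  · exact fun i j hx => hor i j (1 - l) (by linarith) (by linarith) hx
  · exact fun i j hx => ver i j l l0.le l1.le hx
  · exact fun i j hx => ver i j (1 - l) (by linarith) (by linarith) hx

theorem label_of_mem_boundaryPolygon (h : IsEdgeFrame x u v l) (hx : x ∈ boundaryPolygon α T) :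
    pixelLabel α T u = 0 ∧ pixelLabel α T v = 0 := by
  have l0 := h.l_pos
  have l1 := h.l_lt
  have hor : ∀ (i j : ℤ) (s : ℝ), 0 < s → s < 1 → x = (i + s, (j : ℝ)) →
      pixelLabel α T (i, j) = 0 ∧ pixelLabel α T (i + 1, j) = 0 := by
    intro i j s hs0 hs1 hxe
    rw [hxe, ← add_zero (j : ℝ)] at hx
    rcases boundaryPolygon_cases hs0.le hs1 le_rfl one_pos hx with h | h | h | h
    · exact absurd h.1 hs0.ne'
    · exact absurd h.1 hs0.ne'
    · exact h.2.2
    · exact absurd h.2.1 (lt_irrefl _)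
  have ver : ∀ (i j : ℤ) (s : ℝ), 0 < s → s < 1 → x = ((i : ℝ), j + s) →
      pixelLabel α T (i, j) = 0 ∧ pixelLabel α T (i, j + 1) = 0 := by
    intro i j s hs0 hs1 hxe
    rw [hxe, ← add_zero (i : ℝ)] at hx
    rcases boundaryPolygon_cases le_rfl one_pos hs0.le hs1 hx with h | h | h | h
    · exact absurd h.2.1 hs0.ne'
    · exact h.2.2
    · exact absurd h.1 (lt_irrefl _)
    · exact absurd h.1 (lt_irrefl _)
  refine h.induct (p := fun u v _ => pixelLabel α T u = 0 ∧ pixelLabel α T v = 0) ?_ ?_ ?_ ?_ ?_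
  · exact fun u v l h => h.symm
  · exact fun i j hx => hor i j l l0 l1 hx
  · exact fun i j hx => hor i j (1 - l) (by linarith) (by linarith) hx
  · exact fun i j hx => ver i j l l0 l1 hx
  · exact fun i j hx => ver i j (1 - l) (by linarith) (by linarith) hx

theorem mem_boundaryPolygon (h : IsEdgeFrame x u v l) (hu : pixelLabel α T u = 0)
    (hv : pixelLabel α T v = 0) : x ∈ boundaryPolygon α T :=
  mem_boundaryPolygon_of_label hu hv h.adj.of_four h.mem_segment

end IsEdgeFrame

namespace IsSquareFrame

variable {x : ℝ × ℝ} {z e : ℤ × ℤ} {s t : ℝ}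

theorem flip_fst (h : IsSquareFrame x z e s t) :
    IsSquareFrame x (z.1 + e.1, z.2) (-e.1, e.2) (1 - s) t where
  unit_fst := by rcases h.unit_fst with h | h <;> simp [h]
  unit_snd := h.unit_snd
  s_pos := by linarith [h.s_lt]
  s_lt := by linarith [h.s_pos]
  t_pos := h.t_pos
  t_lt := h.t_lt
  eq := by
    rw [h.eq]
    ext <;> push_cast <;> ring

theorem flip_snd (h : IsSquareFrame x z e s t) :
    IsSquareFrame x (z.1, z.2 + e.2) (e.1, -e.2) s (1 - t) where
  unit_fst := h.unit_fst
  unit_snd := by rcases h.unit_snd with h | h <;> simp [h]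
  s_pos := h.s_pos
  s_lt := h.s_lt
  t_pos := by linarith [h.t_lt]
  t_lt := by linarith [h.t_pos]
  eq := by
    rw [h.eq]
    ext <;> push_cast <;> ring

/-- The frame at the opposite corner. -/
theorem flip (h : IsSquareFrame x z e s t) :
    IsSquareFrame x (z.1 + e.1, z.2 + e.2) (-e.1, -e.2) (1 - s) (1 - t) :=
  h.flip_fst.flip_snd

/-- To prove a statement about frames that is invariant under flips, consider positive directions. -/
theorem induct {p : ℤ × ℤ → ℤ × ℤ → ℝ → ℝ → Prop} (h : IsSquareFrame x z e s t)
    (h1 : ∀ z e s t, p (z.1 + e.1, z.2) (-e.1, e.2) (1 - s) t → p z e s t)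
    (h2 : ∀ z e s t, p (z.1, z.2 + e.2) (e.1, -e.2) s (1 - t) → p z e s t)
    (h3 : ∀ z s t, IsSquareFrame x z (1, 1) s t → p z (1, 1) s t) : p z e s t := by
  have aux : ∀ z s t, IsSquareFrame x z (1, -1) s t → p z (1, -1) s t := fun z s t h =>
    h2 _ _ _ _ (by simpa using h3 _ _ _ (by simpa using h.flip_snd))
  obtain ⟨e1, e2⟩ := e
  rcases h.unit_fst with he | he <;> rcases h.unit_snd with he' | he' <;> dsimp only at he he' <;>
    subst he he'
  · exact h3 _ _ _ h
  · exact aux _ _ _ h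
  · exact h1 _ _ _ _ (by simpa using h3 _ _ _ (by simpa using h.flip_fst))
  · exact h1 _ _ _ _ (by simpa using aux _ _ _ (by simpa using h.flip_fst))

theorem labelInterp_eq (h : IsSquareFrame x z e s t) :
    labelInterp α T x = (1 - s) * (1 - t) * pixelLabel α T z +
      s * (1 - t) * pixelLabel α T (z.1 + e.1, z.2) + (1 - s) * t * pixelLabel α T (z.1, z.2 + e.2) +
        s * t * pixelLabel α T (z.1 + e.1, z.2 + e.2) := by
  refine h.induct (p := fun z e s t => labelInterp α T x = (1 - s) * (1 - t) * pixelLabel α T z +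
      s * (1 - t) * pixelLabel α T (z.1 + e.1, z.2) + (1 - s) * t * pixelLabel α T (z.1, z.2 + e.2) +
        s * t * pixelLabel α T (z.1 + e.1, z.2 + e.2)) ?_ ?_ ?_
  · intro z e s t h
    simp only [add_neg_cancel_right] at h
    rw [h]
    ring
  · intro z e s t h
    simp only [add_neg_cancel_right] at h
    rw [h]
    ring
  · intro z s t h
    have := labelInterp_apply (α := α) (T := T) z.1 z.2 h.s_pos.le h.s_lt.le h.t_pos.le h.t_lt.le
    rw [h.eq]
    simpa using this

theorem label_of_mem_boundaryPolygon (h : IsSquareFrame x z e s t)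
    (hx : x ∈ boundaryPolygon α T) : α = .four ∧
      ((s = t ∧ pixelLabel α T z = 0 ∧ pixelLabel α T (z.1 + e.1, z.2 + e.2) = 0) ∨
        (s + t = 1 ∧ pixelLabel α T (z.1 + e.1, z.2) = 0 ∧
          pixelLabel α T (z.1, z.2 + e.2) = 0)) := by
  refine h.induct (p := fun z e s t => α = .four ∧
      ((s = t ∧ pixelLabel α T z = 0 ∧ pixelLabel α T (z.1 + e.1, z.2 + e.2) = 0) ∨
        (s + t = 1 ∧ pixelLabel α T (z.1 + e.1, z.2) = 0 ∧
          pixelLabel α T (z.1, z.2 + e.2) = 0))) ?_ ?_ ?_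
  · rintro z e s t ⟨h1, h2⟩
    simp only [add_neg_cancel_right] at h2
    refine ⟨h1, h2.symm.imp ?_ ?_⟩
    · exact fun h => ⟨by linarith [h.1], h.2⟩
    · exact fun h => ⟨by linarith [h.1], h.2⟩
  · rintro z e s t ⟨h1, h2⟩
    simp only [add_neg_cancel_right] at h2
    refine ⟨h1, h2.symm.imp ?_ ?_⟩
    · exact fun h => ⟨by linarith [h.1], h.2.2, h.2.1⟩
    · exact fun h => ⟨by linarith [h.1], h.2.2, h.2.1⟩
  · intro z s t h
    rw [h.eq] at hx
    simp only [Int.cast_one, one_mul] at hx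
    rcases boundaryPolygon_cases h.s_pos.le h.s_lt h.t_pos.le h.t_lt hx with h' | h' | h' | h'
    · exact absurd h'.1 h.s_pos.ne'
    · exact absurd h'.1 h.s_pos.ne'
    · exact absurd h'.2.1 h.t_pos.ne'
    · exact h'.2.2

theorem mem_boundaryPolygon (h : IsSquareFrame x z e s t) (hα : α = .four) (hst : s + t = 1)
    (h₁ : pixelLabel α T (z.1 + e.1, z.2) = 0) (h₂ : pixelLabel α T (z.1, z.2 + e.2) = 0) :
    x ∈ boundaryPolygon α T := by
  refine mem_boundaryPolygon_of_label h₁ h₂ ?_ ⟨s, t, h.s_pos.le, h.t_pos.le, hst, ?_⟩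
  · subst hα
    rcases h.unit_fst with h1 | h1 <;> rcases h.unit_snd with h2 | h2 <;>
      simp [Connectivity.dual, PixelAdj, pixelDist, h1, h2]
  · obtain rfl : s = 1 - t := by linarith
    rw [h.eq]
    ext <;> simp only [toPlane, Prod.smul_mk, Prod.mk_add_mk, smul_eq_mul] <;> push_cast <;> ring

/-- Either some corner satisfies `p`, and we may take the frame there, or no corner does. -/
theorem exists_or (h : IsSquareFrame x z e s t) (p : ℤ × ℤ → Prop) :
    (∃ z e s t, IsSquareFrame x z e s t ∧ p z) ∨ (¬p z ∧ ¬p (z.1 + e.1, z.2) ∧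
      ¬p (z.1, z.2 + e.2) ∧ ¬p (z.1 + e.1, z.2 + e.2)) := by
  by_contra! hcon
  obtain ⟨h1, h2⟩ := hcon
  exact h1 _ _ _ _ h.flip (h2 (h1 _ _ _ _ h) (h1 _ _ _ _ h.flip_fst) (h1 _ _ _ _ h.flip_snd))

theorem adj_fst (h : IsSquareFrame x z e s t) : PixelAdj α z (z.1 + e.1, z.2) := by
  apply PixelAdj.of_four
  rcases h.unit_fst with h | h <;> simp [PixelAdj, pixelDist, h]

theorem adj_snd (h : IsSquareFrame x z e s t) : PixelAdj α z (z.1, z.2 + e.2) := by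
  apply PixelAdj.of_four
  rcases h.unit_snd with h | h <;> simp [PixelAdj, pixelDist, h]

theorem adj_diag (h : IsSquareFrame x z e s t) : PixelAdj .eight z (z.1 + e.1, z.2 + e.2) := by
  rcases h.unit_fst with h1 | h1 <;> rcases h.unit_snd with h2 | h2 <;>
    simp [PixelAdj, pixelDist, h1, h2]

end IsSquareFrame

theorem pixelLabel_nonneg_of_adj {u v : ℤ × ℤ} (huv : PixelAdj α u v) (hu : pixelLabel α T u = 1) :
    0 ≤ pixelLabel α T v := by
  have := pixelLabel_adj (T := T) huv.symm
  rcases pixelLabel_cases α T v with h | h | h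
  · exact absurd ⟨h, hu⟩ this
  · exact h.ge
  · rw [h]
    exact zero_le_one

/-- The labels of a unit square with an enclosed corner. -/
theorem IsSquareFrame.label_cases {x : ℝ × ℝ} {z e : ℤ × ℤ} {s t : ℝ} (h : IsSquareFrame x z e s t)
    (hz : pixelLabel α T z = 1) :
    0 ≤ pixelLabel α T (z.1 + e.1, z.2) ∧ 0 ≤ pixelLabel α T (z.1, z.2 + e.2) ∧
      (0 ≤ pixelLabel α T (z.1 + e.1, z.2 + e.2) ∨ (α = .four ∧
        pixelLabel α T (z.1 + e.1, z.2) = 0 ∧ pixelLabel α T (z.1, z.2 + e.2) = 0 ∧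
          pixelLabel α T (z.1 + e.1, z.2 + e.2) = -1)) := by
  have h1 := pixelLabel_nonneg_of_adj h.adj_fst hz
  have h2 := pixelLabel_nonneg_of_adj h.adj_snd hz
  refine ⟨h1, h2, ?_⟩
  rcases pixelLabel_cases α T (z.1 + e.1, z.2 + e.2) with h3 | h3 | h3
  · right
    -- Opposite corners labelled 1 and -1 are not `α`-adjacent, which excludes `α = .eight`. The
    -- other two corners are adjacent to both, hence labelled 0.
    have hα : α = .four := by
      cases α
      · rfl
      · have := pixelLabel_nonneg_of_adj h.adj_diag hz
        linarith
    have h3' := pixelLabel_eq_neg_one.1 h3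
    have a1 := h.flip.adj_snd (α := α)
    have a2 := h.flip.adj_fst (α := α)
    simp only [add_neg_cancel_right] at a1 a2
    exact ⟨hα, le_antisymm (pixelLabel_nonpos_of_adj h3' a1) h1,
      le_antisymm (pixelLabel_nonpos_of_adj h3' a2) h2, h3⟩
  · exact Or.inl h3.ge
  · left
    rw [h3]
    exact zero_le_one

end Region

/-! ### Positive interpolated label implies enclosed. -/

section RegionBounds

variable {α : Connectivity} {T : Set (ℤ × ℤ)}

theorem pixelLabel_nonpos_of_ne_one {z : ℤ × ℤ} (h : pixelLabel α T z ≠ 1) :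
    pixelLabel α T z ≤ 0 := by
  rcases pixelLabel_cases α T z with h' | h' | h'
  · linarith
  · exact h'.le
  · contradiction

theorem pixelLabel_nonneg_of_ne_neg_one {z : ℤ × ℤ} (h : pixelLabel α T z ≠ -1) :
    0 ≤ pixelLabel α T z :=
  pixelLabel_nonneg fun hz => h (pixelLabel_eq_neg_one.2 hz)

theorem toPlane_mem_boundaryPolygon_iff {z : ℤ × ℤ} :
    toPlane z ∈ boundaryPolygon α T ↔ pixelLabel α T z = 0 := by
  refine ⟨fun h => ?_, toPlane_mem_boundaryPolygon⟩
  have h' : (((z.1 : ℝ) + 0, (z.2 : ℝ) + 0) : ℝ × ℝ) ∈ boundaryPolygon α T := by simpa [toPlane] using h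
  rcases boundaryPolygon_cases le_rfl one_pos le_rfl one_pos h' with h | h | h | h
  · exact h.2.2
  · exact absurd h.2.1 (lt_irrefl _)
  · exact absurd h.1 (lt_irrefl _)
  · exact absurd h.1 (lt_irrefl _)

/-- If the labels of the corners are nonpositive, each of them bounds the interpolated label. -/
theorem IsSquareFrame.labelInterp_nonpos {x : ℝ × ℝ} {z e : ℤ × ℤ} {s t : ℝ}
    (h : IsSquareFrame x z e s t) (h₀ : pixelLabel α T z ≤ 0)
    (h₁ : pixelLabel α T (z.1 + e.1, z.2) ≤ 0) (h₂ : pixelLabel α T (z.1, z.2 + e.2) ≤ 0)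
    (h₃ : pixelLabel α T (z.1 + e.1, z.2 + e.2) ≤ 0) :
    labelInterp α T x ≤ (1 - s) * (1 - t) * pixelLabel α T z ∧
      labelInterp α T x ≤ s * (1 - t) * pixelLabel α T (z.1 + e.1, z.2) ∧
      labelInterp α T x ≤ (1 - s) * t * pixelLabel α T (z.1, z.2 + e.2) ∧
      labelInterp α T x ≤ s * t * pixelLabel α T (z.1 + e.1, z.2 + e.2) := by
  rw [h.labelInterp_eq]
  have s0 := h.s_pos
  have t0 := h.t_pos
  have s1 : 0 < 1 - s := by linarith [h.s_lt]
  have t1 : 0 < 1 - t := by linarith [h.t_lt]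
  have k0 := mul_nonpos_of_nonneg_of_nonpos (mul_pos s1 t1).le h₀
  have k1 := mul_nonpos_of_nonneg_of_nonpos (mul_pos s0 t1).le h₁
  have k2 := mul_nonpos_of_nonneg_of_nonpos (mul_pos s1 t0).le h₂
  have k3 := mul_nonpos_of_nonneg_of_nonpos (mul_pos s0 t0).le h₃
  refine ⟨?_, ?_, ?_, ?_⟩ <;> linarith

theorem IsSquareFrame.labelInterp_ge {x : ℝ × ℝ} {z e : ℤ × ℤ} {s t : ℝ}
    (h : IsSquareFrame x z e s t) (h₁ : 0 ≤ pixelLabel α T (z.1 + e.1, z.2))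
    (h₂ : 0 ≤ pixelLabel α T (z.1, z.2 + e.2)) :
    (1 - s) * (1 - t) * pixelLabel α T z + s * t * pixelLabel α T (z.1 + e.1, z.2 + e.2) ≤
      labelInterp α T x := by
  rw [h.labelInterp_eq]
  have s0 := h.s_pos
  have t0 := h.t_pos
  have s1 : 0 < 1 - s := by linarith [h.s_lt]
  have t1 : 0 < 1 - t := by linarith [h.t_lt]
  have k1 := mul_nonneg (mul_pos s0 t1).le h₁
  have k2 := mul_nonneg (mul_pos s1 t0).le h₂
  linarith

theorem IsSquareFrame.labelInterp_pos {x : ℝ × ℝ} {z e : ℤ × ℤ} {s t : ℝ}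
    (h : IsSquareFrame x z e s t) (h₀ : pixelLabel α T z = 1)
    (h₁ : 0 ≤ pixelLabel α T (z.1 + e.1, z.2)) (h₂ : 0 ≤ pixelLabel α T (z.1, z.2 + e.2))
    (h₃ : 0 ≤ pixelLabel α T (z.1 + e.1, z.2 + e.2) ∨ s + t < 1) : 0 < labelInterp α T x := by
  have key := h.labelInterp_ge h₁ h₂
  have s0 := h.s_pos
  have t0 := h.t_pos
  have s1 : 0 < 1 - s := by linarith [h.s_lt]
  have t1 : 0 < 1 - t := by linarith [h.t_lt]
  have k1 := mul_pos s1 t1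
  have k2 := mul_pos s0 t0
  rw [h₀] at key
  rcases h₃ with h₃ | h₃
  · have := mul_nonneg k2.le h₃
    linarith
  · have := mul_le_mul_of_nonneg_left
      (neg_one_le_pixelLabel (α := α) (T := T) (z := (z.1 + e.1, z.2 + e.2))) k2.le
    nlinarith

/-- The points near a point of an open unit square lie in the same square. -/
theorem IsSquareFrame.eventually {x : ℝ × ℝ} {z e : ℤ × ℤ} {s t : ℝ}
    (h : IsSquareFrame x z e s t) : ∀ᶠ y in nhds x, ∃ s t, IsSquareFrame y z e s t := by
  have u1 := sq_eq_one_of_unit h.unit_fst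
  have u2 := sq_eq_one_of_unit h.unit_snd
  have hx1 : (e.1 : ℝ) * (x.1 - z.1) = s := by
    rw [h.eq]
    linear_combination s * u1
  have hx2 : (e.2 : ℝ) * (x.2 - z.2) = t := by
    rw [h.eq]
    linear_combination t * u2
  have c1 : Continuous fun y : ℝ × ℝ => (e.1 : ℝ) * (y.1 - z.1) := by fun_prop
  have c2 : Continuous fun y : ℝ × ℝ => (e.2 : ℝ) * (y.2 - z.2) := by fun_prop
  have m1 : Set.Ioo (0 : ℝ) 1 ∈ nhds ((e.1 : ℝ) * (x.1 - z.1)) := by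
    rw [hx1]
    exact Ioo_mem_nhds h.s_pos h.s_lt
  have m2 : Set.Ioo (0 : ℝ) 1 ∈ nhds ((e.2 : ℝ) * (x.2 - z.2)) := by
    rw [hx2]
    exact Ioo_mem_nhds h.t_pos h.t_lt
  filter_upwards [c1.continuousAt.eventually_mem m1, c2.continuousAt.eventually_mem m2] with y h1 h2
  refine ⟨_, _, h.unit_fst, h.unit_snd, h1.1, h1.2, h2.1, h2.2, ?_⟩
  ext
  · dsimp only
    linear_combination (-(y.1 - z.1)) * u1
  · dsimp only
    linear_combination (-(y.2 - z.2)) * u2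

/-- The boundary of the positivity set of the interpolated label is part of the boundary polygon. -/
theorem frontier_labelInterp_pos_subset (hT : T.Finite) :
    frontier {x | 0 < labelInterp α T x} ⊆ boundaryPolygon α T := by
  intro x hx
  have h0 : labelInterp α T x = 0 :=
    (frontier_lt_subset_eq continuous_const (continuous_labelInterp hT) hx).symm
  rcases vertex_or_edge_or_square x with ⟨z, rfl⟩ | ⟨u, v, l, h⟩ | ⟨z, e, s, t, h⟩
  · rw [labelInterp_toPlane] at h0
    exact toPlane_mem_boundaryPolygon h0
  · rw [h.labelInterp_eq] at h0
    have l0 := h.l_pos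
    have l1 := h.l_lt
    have hb : pixelLabel α T u = 0 ∧ pixelLabel α T v = 0 := by
      rcases pixelLabel_cases α T u with hu | hu | hu
      · have := pixelLabel_nonpos_of_adj (pixelLabel_eq_neg_one.1 hu) h.adj.of_four
        have := mul_nonpos_of_nonneg_of_nonpos l0.le this
        rw [hu] at h0
        linarith
      · rw [hu, mul_zero, zero_add, mul_eq_zero] at h0
        exact ⟨hu, h0.resolve_left l0.ne'⟩
      · have := mul_nonneg l0.le (pixelLabel_nonneg_of_adj h.adj.of_four hu)
        rw [hu] at h0
        linarith
    exact h.mem_boundaryPolygon hb.1 hb.2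
  · rcases h.exists_or (fun w => pixelLabel α T w = 1) with ⟨z, e, s, t, h, hz⟩ | ⟨n0, n1, n2, n3⟩
    · obtain ⟨h1, h2, h3 | ⟨hα, h1', h2', h3⟩⟩ := h.label_cases hz
      · exact absurd h0 (h.labelInterp_pos hz h1 h2 (Or.inl h3)).ne'
      -- Labels 1, 0, 0, -1 interpolate to `1 - s - t`, whose zero set is the diagonal edge of the
      -- polygon.
      · rw [h.labelInterp_eq, hz, h1', h2', h3] at h0
        exact h.mem_boundaryPolygon hα (by linarith) h1' h2'
    · exfalso
      -- With no corner labelled 1 the interpolation is nonpositive on the whole open square, yet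
      -- `x` is a limit of points where it is positive.
      obtain ⟨y, hypos, s, t, hy⟩ :=
        ((mem_closure_iff_frequently.1 (frontier_subset_closure hx)).and_eventually h.eventually).exists
      have := (hy.labelInterp_nonpos (pixelLabel_nonpos_of_ne_one n0) (pixelLabel_nonpos_of_ne_one n1)
        (pixelLabel_nonpos_of_ne_one n2) (pixelLabel_nonpos_of_ne_one n3)).1
      have s1 : 0 < 1 - s := by linarith [hy.s_lt]
      have t1 : 0 < 1 - t := by linarith [hy.t_lt]
      have := mul_nonpos_of_nonneg_of_nonpos (mul_pos s1 t1).le (pixelLabel_nonpos_of_ne_one n0)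
      have h2 : 0 < labelInterp α T y := hypos
      linarith

/-- A point of this set is within sup-distance 1 of one of the finitely many pixels off the exterior
region. -/
theorem isBounded_labelInterp_pos (hT : T.Finite) :
    Bornology.IsBounded {x | 0 < labelInterp α T x} := by
  refine ((Bornology.isBounded_biUnion (finite_compl_exteriorRegion (α := α) hT)).2
    fun z _ => Metric.isBounded_closedBall (x := toPlane z) (r := 1)).subset fun x hx => ?_
  obtain ⟨i, j, s, t, hs0, hs1, ht0, ht1, rfl⟩ := exists_lattice_coords x
  simp only [Set.mem_iUnion, Set.mem_compl_iff]
  by_contra! hcon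
  have hE : ∀ z : ℤ × ℤ, ((i + s, j + t) : ℝ × ℝ) ∈ Metric.closedBall (toPlane z) 1 →
      pixelLabel α T z = -1 := by
    intro z hz
    rw [pixelLabel_eq_neg_one]
    by_contra h
    exact hcon z h hz
  have hb : ∀ a b : ℤ, (a = i ∨ a = i + 1) → (b = j ∨ b = j + 1) → pixelLabel α T (a, b) = -1 := by
    intro a b ha hb
    apply hE
    rw [Metric.mem_closedBall, Prod.dist_eq, Real.dist_eq, Real.dist_eq]
    apply max_le <;> rw [abs_le]
    · rcases ha with rfl | rfl <;> simp only [toPlane] <;> push_cast <;> constructor <;> linarith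
    · rcases hb with rfl | rfl <;> simp only [toPlane] <;> push_cast <;> constructor <;> linarith
  have hx' : 0 < labelInterp α T (i + s, j + t) := hx
  rw [labelInterp_apply i j hs0 hs1.le ht0 ht1.le, hb _ _ (Or.inl rfl) (Or.inl rfl),
    hb _ _ (Or.inr rfl) (Or.inl rfl), hb _ _ (Or.inl rfl) (Or.inr rfl),
    hb _ _ (Or.inr rfl) (Or.inr rfl)] at hx'
  linarith

/-- A point off the boundary polygon at which the interpolated label is positive is enclosed. -/
theorem mem_polygonRegion_of_labelInterp_pos (hT : T.Finite) {x : ℝ × ℝ}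
    (hxB : x ∉ boundaryPolygon α T) (hx : 0 < labelInterp α T x) : x ∈ polygonRegion α T := by
  refine ⟨hxB, (isBounded_labelInterp_pos (α := α) hT).subset ?_⟩
  have hxC : x ∈ connectedComponentIn (boundaryPolygon α T)ᶜ x := mem_connectedComponentIn hxB
  have hopen : IsOpen {x | 0 < labelInterp α T x} :=
    isOpen_lt continuous_const (continuous_labelInterp hT)
  -- The component avoids the frontier of the positivity set, which is thus open and closed relative
  -- to it and contains it entirely.
  have hcl : ∀ y ∈ connectedComponentIn (boundaryPolygon α T)ᶜ x,
      y ∈ closure {x | 0 < labelInterp α T x} → 0 < labelInterp α T y := by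
    intro y hy hyc
    by_contra hcon
    refine connectedComponentIn_subset _ _ hy (frontier_labelInterp_pos_subset hT ⟨hyc, ?_⟩)
    rwa [hopen.interior_eq]
  intro y hy
  by_contra hcon
  obtain ⟨w, -, hw, hw'⟩ := isPreconnected_connectedComponentIn
    (F := (boundaryPolygon α T)ᶜ) (x := x) {x | 0 < labelInterp α T x}
    (closure {x | 0 < labelInterp α T x})ᶜ hopen isClosed_closure.isOpen_compl
    (fun y hy => or_iff_not_imp_right.2 fun h => hcl y hy (not_not.1 h)) ⟨x, hxC, hx⟩
    ⟨y, hy, fun h => hcon (hcl y hy h)⟩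
  exact hw' (subset_closure hw)

theorem mem_latticeRegion_of_label_eq_one (hT : T.Finite) {z : ℤ × ℤ}
    (hz : pixelLabel α T z = 1) : z ∈ latticeRegion α T := by
  refine mem_polygonRegion_of_labelInterp_pos hT ?_ ?_
  · rw [toPlane_mem_boundaryPolygon_iff, hz]
    exact one_ne_zero
  · rw [labelInterp_toPlane, hz]
    exact one_pos

end RegionBounds

/-! ### Enclosed points have nonnegative interpolated label. -/

section Unbounded

variable {α : Connectivity} {T : Set (ℤ × ℤ)}

theorem finite_preimage_toPlane {S : Set (ℝ × ℝ)} (hS : Bornology.IsBounded S) :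
    (toPlane ⁻¹' S).Finite := by
  obtain ⟨R, hR⟩ := hS.subset_closedBall 0
  refine ((Set.finite_Icc (-⌈R⌉) ⌈R⌉).prod (Set.finite_Icc (-⌈R⌉) ⌈R⌉)).subset fun z hz => ?_
  have h := hR hz
  rw [mem_closedBall_zero_iff, Prod.norm_def, max_le_iff, Real.norm_eq_abs, Real.norm_eq_abs] at h
  have key : ∀ k : ℤ, |(k : ℝ)| ≤ R → k ∈ Set.Icc (-⌈R⌉) ⌈R⌉ := by
    intro k hk
    have : ((|k| : ℤ) : ℝ) ≤ ⌈R⌉ := by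
      push_cast
      exact hk.trans (Int.le_ceil R)
    exact abs_le.1 (by exact_mod_cast this)
  exact ⟨key _ h.1, key _ h.2⟩

/-- An `α`-edge in the exterior region does not meet the boundary polygon. -/
theorem segment_exteriorRegion_subset {u v : ℤ × ℤ} (hu : u ∈ exteriorRegion α T)
    (hv : v ∈ exteriorRegion α T) (huv : PixelAdj α u v) :
    segment ℝ (toPlane u) (toPlane v) ⊆ (boundaryPolygon α T)ᶜ := by
  intro x hx hxB
  obtain ⟨i, j, s, t, hs0, hs1, ht0, ht1, rfl⟩ := exists_lattice_coords x
  have h1 := edge_cases huv.to_eight (fun w => pixelLabel α T w = -1)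
    (pixelLabel_eq_neg_one.2 hu) (pixelLabel_eq_neg_one.2 hv) hs0 hs1 ht0 ht1 hx
  have h2 := boundaryPolygon_cases hs0 hs1 ht0 ht1 hxB
  have hne : ∀ w, pixelLabel α T w = -1 → pixelLabel α T w ≠ 0 := fun w h => by
    rw [h]
    norm_num
  rcases h1 with ⟨a1, a2, a3⟩ | ⟨a1, a2, a3, -⟩ | ⟨a1, a2, a3, -⟩ | ⟨a1, a2, a3, -⟩
  · rcases h2 with h | h | h | h
    · exact hne _ a3 h.2.2
    · exact h.2.1.ne' a2
    · exact h.1.ne' a1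
    · exact h.1.ne' a1
  · rcases h2 with h | h | h | h
    · exact hne _ a3 h.2.2
    · exact hne _ a3 h.2.2.1
    · exact h.1.ne' a1
    · exact h.1.ne' a1
  · rcases h2 with h | h | h | h
    · exact hne _ a3 h.2.2
    · exact hne _ a3 h.2.2.1
    · exact hne _ a3 h.2.2.1
    · exact h.2.1.ne' a2
  · rcases h2 with h | h | h | h
    · exact a1.ne' h.1
    · exact a1.ne' h.1
    · exact a2.ne' h.2.1
    -- Both edges would be diagonal, but `α`-edges and polygon edges have dual adjacencies.
    · obtain rfl := h.2.2.1
      exact a3 huv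

/-- A point joined to the exterior region off the boundary polygon is not enclosed. -/
theorem not_mem_polygonRegion_of_segment {x : ℝ × ℝ} {z : ℤ × ℤ} (hz : z ∈ exteriorRegion α T)
    (hxz : segment ℝ x (toPlane z) ⊆ (boundaryPolygon α T)ᶜ) : x ∉ polygonRegion α T := by
  rintro ⟨hxB, hb⟩
  obtain ⟨-, hinf⟩ := mem_exteriorRegion.1 hz
  -- The component of `x` contains the whole infinite white component of `z`, whereas a bounded set
  -- has finitely many lattice points.
  refine hinf ((finite_preimage_toPlane hb).subset fun w hw => ?_)
  have hzC := mem_connectedComponentIn_of_segment (mem_connectedComponentIn hxB) hxz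
  refine (PixelLinked.induct hw (p := fun w => w ∈ exteriorRegion α T ∧
    toPlane w ∈ connectedComponentIn (boundaryPolygon α T)ᶜ x) ⟨hz, hzC⟩ ?_).2
  rintro a b ⟨ha, haC⟩ _ hb hab
  have hbE := exteriorRegion_of_adj ha hab hb
  exact ⟨hbE, mem_connectedComponentIn_of_segment haC (segment_exteriorRegion_subset ha hbE hab)⟩

/-- Towards `z` the frame coordinates shrink proportionally. As `z` is not labelled 0, the only
polygon edge possible in the open square is the diagonal `s + t = 1`, which is then out of reach. -/
theorem IsSquareFrame.segment_subset {x : ℝ × ℝ} {z e : ℤ × ℤ} {s t : ℝ}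
    (h : IsSquareFrame x z e s t) (hz : pixelLabel α T z = -1)
    (hst : α = .four → pixelLabel α T (z.1 + e.1, z.2) = 0 → pixelLabel α T (z.1, z.2 + e.2) = 0 →
      s + t < 1) : segment ℝ x (toPlane z) ⊆ (boundaryPolygon α T)ᶜ := by
  rintro y ⟨a, b, ha, hb, hab, rfl⟩ hy
  rcases ha.eq_or_lt with rfl | ha
  · obtain rfl : b = 1 := by linarith
    rw [zero_smul, one_smul, zero_add, toPlane_mem_boundaryPolygon_iff, hz] at hy
    norm_num at hy
  · have ha1 : a ≤ 1 := by linarith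
    have s0 := h.s_pos
    have t0 := h.t_pos
    have s1 := h.s_lt
    have t1 := h.t_lt
    have hf : IsSquareFrame (a • x + b • toPlane z) z e (a * s) (a * t) := by
      refine ⟨h.unit_fst, h.unit_snd, mul_pos ha s0, ?_, mul_pos ha t0, ?_, ?_⟩
      · nlinarith
      · nlinarith
      · obtain rfl : b = 1 - a := by linarith
        rw [h.eq]
        ext <;> simp only [toPlane, Prod.smul_mk, Prod.mk_add_mk, smul_eq_mul] <;> ring
    obtain ⟨hα, ⟨-, h0, -⟩ | ⟨hsum, h1, h2⟩⟩ := hf.label_of_mem_boundaryPolygon hy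
    · rw [hz] at h0
      norm_num at h0
    · have := hst hα h1 h2
      nlinarith

theorem IsEdgeFrame.segment_subset {x : ℝ × ℝ} {u v : ℤ × ℤ} {l : ℝ}
    (h : IsEdgeFrame x u v l) (hu : pixelLabel α T u = -1) :
    segment ℝ x (toPlane u) ⊆ (boundaryPolygon α T)ᶜ := by
  rintro y ⟨a, b, ha, hb, hab, rfl⟩ hy
  rcases ha.eq_or_lt with rfl | ha
  · obtain rfl : b = 1 := by linarith
    rw [zero_smul, one_smul, zero_add, toPlane_mem_boundaryPolygon_iff, hu] at hy
    norm_num at hy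
  · have l0 := h.l_pos
    have l1 := h.l_lt
    have hf : IsEdgeFrame (a • x + b • toPlane u) u v (a * l) := by
      refine ⟨h.adj, mul_pos ha l0, by nlinarith, ?_⟩
      obtain rfl : b = 1 - a := by linarith
      rw [h.eq]
      ext <;> simp only [toPlane, Prod.smul_mk, Prod.mk_add_mk, smul_eq_mul] <;> ring
    have := (hf.label_of_mem_boundaryPolygon hy).1
    rw [hu] at this
    norm_num at this

/-- The interpolated label is nonnegative on the region enclosed by the boundary polygon. -/
theorem labelInterp_nonneg_of_mem_polygonRegion (hT : T.Finite)
    (hTc : ∀ u ∈ T, ∀ v ∈ T, PixelLinked α T u v) {x : ℝ × ℝ} (hx : x ∈ polygonRegion α T) :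
    0 ≤ labelInterp α T x := by
  rcases vertex_or_edge_or_square x with ⟨z, rfl⟩ | ⟨u, v, l, h⟩ | ⟨z, e, s, t, h⟩
  · rw [labelInterp_toPlane]
    apply pixelLabel_nonneg
    intro hz
    refine not_mem_polygonRegion_of_segment hz ?_ hx
    rw [segment_same]
    exact Set.singleton_subset_iff.2 hx.1
  · rw [h.labelInterp_eq]
    have hu : 0 ≤ pixelLabel α T u := pixelLabel_nonneg_of_ne_neg_one fun hu =>
      not_mem_polygonRegion_of_segment (pixelLabel_eq_neg_one.1 hu) (h.segment_subset hu) hx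
    have hv : 0 ≤ pixelLabel α T v := pixelLabel_nonneg_of_ne_neg_one fun hv =>
      not_mem_polygonRegion_of_segment (pixelLabel_eq_neg_one.1 hv) (h.flip.segment_subset hv) hx
    have l0 := h.l_pos
    have l1 : 0 < 1 - l := by linarith [h.l_lt]
    positivity
  · by_contra! hneg
    rcases h.exists_or (fun w => pixelLabel α T w = -1) with ⟨z, e, s, t, h, hz⟩ | ⟨n0, n1, n2, n3⟩
    · have hzE := pixelLabel_eq_neg_one.1 hz
      refine not_mem_polygonRegion_of_segment hzE (h.segment_subset hz fun hα h1 h2 => ?_) hx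
      by_contra! hst
      rcases hst.eq_or_lt with hst | hst
      · exact hx.1 (h.mem_boundaryPolygon hα hst.symm h1 h2)
      -- The diagonal edge separates `x` from `z`, so the opposite corner decides: -1 gives another
      -- way out, 0 is a forbidden triangle, and 1 gives the value `s + t - 1 > 0`.
      rcases pixelLabel_cases α T (z.1 + e.1, z.2 + e.2) with h3 | h3 | h3
      · refine not_mem_polygonRegion_of_segment (pixelLabel_eq_neg_one.1 h3)
          (h.flip.segment_subset h3 fun _ _ _ => ?_) hx
        linarith
      · have hf := h.flip
        refine not_label_eq_zero_of_corners hT hTc _ _ hf.unit_fst hf.unit_snd h3 ?_ ?_ ?_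
        · simpa using h2
        · simpa using h1
        · rintro rfl
          cases hα
      · rw [h.labelInterp_eq, hz, h1, h2, h3] at hneg
        linarith
    · have s0 := h.s_pos
      have t0 := h.t_pos
      have s1 : 0 < 1 - s := by linarith [h.s_lt]
      have t1 : 0 < 1 - t := by linarith [h.t_lt]
      have := h.labelInterp_ge (pixelLabel_nonneg_of_ne_neg_one n1)
        (pixelLabel_nonneg_of_ne_neg_one n2)
      have := mul_nonneg (mul_pos s1 t1).le (pixelLabel_nonneg_of_ne_neg_one n0)
      have := mul_nonneg (mul_pos s0 t0).le (pixelLabel_nonneg_of_ne_neg_one n3)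
      linarith

end Unbounded

/-! ### Nested families and disjointness of tiles. -/

section Tiles

variable {α : Connectivity} {T₁ T₂ : Set (ℤ × ℤ)}

theorem pixelLabel_nonpos_of_label_eq_zero (h : T₁ ⊆ exteriorRegion α T₂) {z : ℤ × ℤ}
    (hz : pixelLabel α T₁ z = 0) : pixelLabel α T₂ z ≤ 0 := by
  obtain ⟨⟨-, t, ht, hzt⟩, -⟩ := pixelLabel_eq_zero.1 hz
  exact pixelLabel_nonpos_of_adj (h ht) hzt.symm

/-- If two sets lie in the exterior regions of each other, then every pixel enclosed by both belongs
to a set of the nested family of the first one, with a boundary polygon no larger than that of the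
first set. -/
theorem exists_mem_nestedFamily (hfin : T₁.Finite) (h₁₂ : T₁ ⊆ exteriorRegion α T₂)
    (h₂₁ : T₂ ⊆ exteriorRegion α T₁) {z : ℤ × ℤ} (h₁ : pixelLabel α T₁ z = 1)
    (h₂ : pixelLabel α T₂ z = 1) :
    ∃ D ∈ nestedFamily α T₁, D.Finite ∧ z ∈ D ∧ boundaryPolygon α D ⊆ boundaryPolygon α T₁ ∧
      ∀ u ∈ D, ∀ v, PixelAdj α u v → pixelLabel α T₁ v = 1 → pixelLabel α T₂ v = 1 → v ∈ D := by
  set F : Set (ℤ × ℤ) := {w | pixelLabel α T₁ w = 1 ∧ pixelLabel α T₂ w = 1} with hF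
  set D : Set (ℤ × ℤ) := {w | PixelLinked α F z w} with hD
  have hDF : D ⊆ F := fun w hw => hw.mem ⟨h₁, h₂⟩
  have hDfin : D.Finite := (finite_compl_exteriorRegion (α := α) hfin).subset fun w hw =>
    (pixelLabel_eq_one.1 (hDF hw).1).1
  have hclosed : ∀ u ∈ D, ∀ v, PixelAdj α u v → pixelLabel α T₁ v = 1 → pixelLabel α T₂ v = 1 →
      v ∈ D := fun u hu v huv hv₁ hv₂ => hu.tail ⟨hDF hu, ⟨hv₁, hv₂⟩, huv⟩
  have hDT : ∀ w ∈ D, w ∉ T₁ := by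
    intro w hw hwT
    have := (hDF hw).2
    rw [pixelLabel_eq_neg_one.2 (h₁₂ hwT)] at this
    norm_num at this
  -- A perimeter pixel of `T₁` touches `T₁`, which is exterior for `T₂`, so its label for `T₂` is at
  -- most 0.
  have hDP : D ⊆ (charImage α T₁).pixels .white := by
    intro w hw
    rw [mem_white_charImage]
    rintro ⟨-, t, ht, hwt⟩
    have := pixelLabel_nonpos_of_adj (h₁₂ ht) hwt.symm
    rw [(hDF hw).2] at this
    norm_num at this
  refine ⟨D, ⟨BinaryImage.isWhiteConnected_iff.2 ⟨hDP, ⟨z, .refl⟩, ?_⟩, ?_⟩, hDfin, .refl, ?_,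
    hclosed⟩
  · exact fun a ha b hb => ha.linked_component.symm.trans hb.linked_component
  · exact fun w hw => ⟨mem_latticeRegion_of_label_eq_one hfin (hDF hw).1, hDT w hw⟩
  -- Such a `w` touches `D`, so both its labels are nonnegative. If the label for `T₁` were 1, the
  -- label for `T₂` could not be 0, since `w` would touch `T₂`, which is exterior for `T₁`; nor
  -- could it be 1, since `w` would belong to `D`.
  · have hsub : ∀ w ∈ exteriorSitePerimeter α D, pixelLabel α T₁ w = 0 := by
      rintro w ⟨⟨hwD, d, hd, hwd⟩, -⟩
      have k₁ := pixelLabel_nonneg_of_adj hwd.symm (hDF hd).1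
      have k₂ := pixelLabel_nonneg_of_adj hwd.symm (hDF hd).2
      rcases pixelLabel_cases α T₁ w with hw₁ | hw₁ | hw₁
      · linarith
      · exact hw₁
      · rcases pixelLabel_cases α T₂ w with hw₂ | hw₂ | hw₂
        · linarith
        · have := pixelLabel_nonpos_of_label_eq_zero h₂₁ hw₂
          linarith
        · exact absurd (hclosed d hd w hwd.symm hw₁ hw₂) hwD
    rintro x (⟨u, hu, rfl⟩ | ⟨u, hu, v, hv, huv, hx⟩)
    · exact toPlane_mem_boundaryPolygon (hsub u hu)
    · refine mem_boundaryPolygon_of_label (hsub u hu) (hsub v hv) ?_ hx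
      rcases huv with h | h
      · exact absurd hu.1 (mem_white_charImage.1 h.1)
      · exact h.2.2

/-- An enclosed point of an open unit square is in good position with respect to some enclosed
corner. -/
theorem IsSquareFrame.exists_frame {T : Set (ℤ × ℤ)} (hT : T.Finite)
    (hTc : ∀ u ∈ T, ∀ v ∈ T, PixelLinked α T u v) {x : ℝ × ℝ} (hx : x ∈ polygonRegion α T)
    {z e : ℤ × ℤ} {s t : ℝ} (h : IsSquareFrame x z e s t) :
    ∃ z e s t, IsSquareFrame x z e s t ∧ pixelLabel α T z = 1 ∧ (s + t < 1 ∨ α = .eight ∨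
      pixelLabel α T (z.1 + e.1, z.2) = 1 ∨ pixelLabel α T (z.1, z.2 + e.2) = 1) := by
  have hnn := labelInterp_nonneg_of_mem_polygonRegion hT hTc hx
  rcases h.exists_or (fun w => pixelLabel α T w = 1) with ⟨z, e, s, t, h, hz⟩ | ⟨n0, n1, n2, n3⟩
  · obtain hα | hα : α = .four ∨ α = .eight := by cases α <;> simp
    swap
    · exact ⟨z, e, s, t, h, hz, Or.inr (Or.inl hα)⟩
    by_cases h1 : pixelLabel α T (z.1 + e.1, z.2) = 1
    · exact ⟨z, e, s, t, h, hz, Or.inr (Or.inr (Or.inl h1))⟩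
    by_cases h2 : pixelLabel α T (z.1, z.2 + e.2) = 1
    · exact ⟨z, e, s, t, h, hz, Or.inr (Or.inr (Or.inr h2))⟩
    obtain ⟨k1, k2, -⟩ := h.label_cases hz
    have h1' := le_antisymm (pixelLabel_nonpos_of_ne_one h1) k1
    have h2' := le_antisymm (pixelLabel_nonpos_of_ne_one h2) k2
    rcases lt_trichotomy (s + t) 1 with hst | hst | hst
    · exact ⟨z, e, s, t, h, hz, Or.inl hst⟩
    · exact absurd (h.mem_boundaryPolygon hα hst h1' h2') hx.1
    -- Beyond the diagonal the opposite corner decides: -1 would make the interpolation `1 - s - t`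
    -- negative, 0 is a forbidden triangle, and 1 provides the frame.
    · have hf := h.flip
      rcases pixelLabel_cases α T (z.1 + e.1, z.2 + e.2) with h3 | h3 | h3
      · rw [h.labelInterp_eq, hz, h1', h2', h3] at hnn
        linarith
      · exfalso
        refine not_label_eq_zero_of_corners hT hTc _ _ hf.unit_fst hf.unit_snd h3 ?_ ?_ ?_
        · simpa using h2'
        · simpa using h1'
        · rintro rfl
          cases hα
      · exact ⟨_, _, _, _, hf, h3, Or.inl (by linarith)⟩
  · exfalso
    obtain ⟨m0, m1, m2, m3⟩ := h.labelInterp_nonpos (pixelLabel_nonpos_of_ne_one n0)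
      (pixelLabel_nonpos_of_ne_one n1) (pixelLabel_nonpos_of_ne_one n2)
      (pixelLabel_nonpos_of_ne_one n3)
    have s0 := h.s_pos
    have t0 := h.t_pos
    have s1 : 0 < 1 - s := by linarith [h.s_lt]
    have t1 : 0 < 1 - t := by linarith [h.t_lt]
    -- With no enclosed corner all labels are nonpositive, so a nonnegative interpolation forces all
    -- four to be 0.
    have key : ∀ (w : ℤ × ℤ) (c : ℝ), 0 < c → labelInterp α T x ≤ c * pixelLabel α T w →
        pixelLabel α T w ≠ 1 → pixelLabel α T w = 0 := by
      intro w c hc hle hw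
      exact le_antisymm (pixelLabel_nonpos_of_ne_one hw)
        (nonneg_of_mul_nonneg_right (hnn.trans hle) hc)
    exact not_label_eq_zero_of_corners hT hTc _ _ h.unit_fst h.unit_snd
      (key _ _ (mul_pos s1 t1) m0 n0) (key _ _ (mul_pos s0 t1) m1 n1) (key _ _ (mul_pos s1 t0) m2 n2)
      fun _ => key _ _ (mul_pos s0 t0) m3 n3

/-- In an open unit square, an exterior corner close to `x` makes the interpolated label negative. -/
theorem IsSquareFrame.labelInterp_neg {T : Set (ℤ × ℤ)} {x : ℝ × ℝ} {z e : ℤ × ℤ} {s t : ℝ}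
    (h : IsSquareFrame x z e s t) (hz : pixelLabel α T z = -1)
    (hst : s + t < 1 ∨ α = .eight ∨ pixelLabel α T (z.1 + e.1, z.2) ≠ 0 ∨
      pixelLabel α T (z.1, z.2 + e.2) ≠ 0) : labelInterp α T x < 0 := by
  have hzE := pixelLabel_eq_neg_one.1 hz
  have h1 : pixelLabel α T (z.1 + e.1, z.2) ≤ 0 := pixelLabel_nonpos_of_adj hzE h.adj_fst
  have h2 : pixelLabel α T (z.1, z.2 + e.2) ≤ 0 := pixelLabel_nonpos_of_adj hzE h.adj_snd
  have s0 := h.s_pos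
  have t0 := h.t_pos
  have s1 : 0 < 1 - s := by linarith [h.s_lt]
  have t1 : 0 < 1 - t := by linarith [h.t_lt]
  by_cases h3 : pixelLabel α T (z.1 + e.1, z.2 + e.2) = 1
  · have hf := h.flip
    have a1 := hf.adj_fst (α := α)
    have a2 := hf.adj_snd (α := α)
    simp only [add_neg_cancel_right] at a1 a2
    have k2 := le_antisymm h2 (pixelLabel_nonneg_of_adj a1 h3)
    have k1 := le_antisymm h1 (pixelLabel_nonneg_of_adj a2 h3)
    rcases hst with hst | rfl | hst | hst
    · rw [h.labelInterp_eq, hz, k1, k2, h3]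
      linarith
    · have := pixelLabel_nonpos_of_adj hzE h.adj_diag
      linarith
    · exact absurd k1 hst
    · exact absurd k2 hst
  · have := (h.labelInterp_nonpos (by rw [hz]; norm_num) h1 h2 (pixelLabel_nonpos_of_ne_one h3)).1
    have := mul_pos s1 t1
    rw [hz] at *
    linarith

/-- The tiles of two sets that lie in the exterior regions of each other are disjoint. -/
theorem disjoint_polygonalTile_of_exterior (hfin₁ : T₁.Finite) (hfin₂ : T₂.Finite)
    (hc₁ : ∀ u ∈ T₁, ∀ v ∈ T₁, PixelLinked α T₁ u v)
    (hc₂ : ∀ u ∈ T₂, ∀ v ∈ T₂, PixelLinked α T₂ u v) (h₁₂ : T₁ ⊆ exteriorRegion α T₂)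
    (h₂₁ : T₂ ⊆ exteriorRegion α T₁) {x : ℝ × ℝ} (hx₁ : x ∈ polygonalTile α T₁) :
    x ∉ polygonRegion α T₂ := by
  intro hx₂
  obtain ⟨hx₁, hM⟩ := hx₁
  simp only [Set.mem_iUnion, not_exists] at hM
  have hH₁ := labelInterp_nonneg_of_mem_polygonRegion hfin₁ hc₁ hx₁
  have hH₂ := labelInterp_nonneg_of_mem_polygonRegion hfin₂ hc₂ hx₂
  -- The tile omits the region of `D`, and `x` is off the polygon of `D`, so the interpolation for
  -- `D` cannot be positive at `x`.
  have hD : ∀ z, pixelLabel α T₁ z = 1 → pixelLabel α T₂ z = 1 → ∃ D : Set (ℤ × ℤ), D.Finite ∧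
      z ∈ D ∧ labelInterp α D x ≤ 0 ∧ ∀ u ∈ D, ∀ v, PixelAdj α u v → pixelLabel α T₁ v = 1 →
        pixelLabel α T₂ v = 1 → v ∈ D := by
    intro z h₁ h₂
    obtain ⟨D, hDM, hDfin, hzD, hB, hcl⟩ := exists_mem_nestedFamily hfin₁ h₁₂ h₂₁ h₁ h₂
    refine ⟨D, hDfin, hzD, ?_, hcl⟩
    by_contra! hpos
    exact hM D hDM (mem_polygonRegion_of_labelInterp_pos hDfin (fun h => hx₁.1 (hB h)) hpos)
  have hne : ∀ z, pixelLabel α T₁ z = 1 → pixelLabel α T₂ z ≠ 0 := by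
    intro z h₁ h₂
    have := pixelLabel_nonpos_of_label_eq_zero h₂₁ h₂
    linarith
  have hone : ∀ z, pixelLabel α T₁ z = 1 → pixelLabel α T₂ z ≠ -1 → pixelLabel α T₂ z = 1 := by
    intro z h₁ h₂
    rcases pixelLabel_cases α T₂ z with h | h | h
    · exact absurd h h₂
    · exact absurd h (hne z h₁)
    · exact h
  rcases vertex_or_edge_or_square x with ⟨z, rfl⟩ | ⟨u, v, l, h⟩ | ⟨z, e, s, t, h⟩
  · rw [labelInterp_toPlane] at hH₁ hH₂
    have h₁ : pixelLabel α T₁ z = 1 := by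
      have := mt toPlane_mem_boundaryPolygon hx₁.1
      rcases pixelLabel_cases α T₁ z with h | h | h
      · linarith
      · contradiction
      · exact h
    have h₂ : pixelLabel α T₂ z = 1 := hone z h₁ fun h => by linarith
    obtain ⟨D, hDfin, hzD, hle, -⟩ := hD z h₁ h₂
    rw [labelInterp_toPlane, pixelLabel_eq_one_of_mem hDfin hzD] at hle
    norm_num at hle
  -- An endpoint labelled 1 for `T₁` would be enclosed by both sets and make the interpolation for
  -- `D` positive. Hence both labels are 0 and `x` is on the polygon of `T₁`.
  · have aux : ∀ u v l, IsEdgeFrame x u v l → pixelLabel α T₁ u ≠ 1 := by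
      intro u v l h h₁
      have l0 := h.l_pos
      have l1 : 0 < 1 - l := by linarith [h.l_lt]
      have h₂ : pixelLabel α T₂ u = 1 := by
        refine hone u h₁ fun h₂ => ?_
        have := pixelLabel_nonpos_of_adj (pixelLabel_eq_neg_one.1 h₂) h.adj.of_four
        have := mul_nonpos_of_nonneg_of_nonpos l0.le this
        rw [h.labelInterp_eq, h₂] at hH₂
        linarith
      obtain ⟨D, hDfin, huD, hle, -⟩ := hD u h₁ h₂
      have := mul_nonneg l0.le (pixelLabel_nonneg_of_adj_mem (α := α) hDfin huD h.adj.of_four)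
      rw [h.labelInterp_eq, pixelLabel_eq_one_of_mem hDfin huD] at hle
      linarith
    have hu := pixelLabel_nonpos_of_ne_one (aux u v l h)
    have hv := pixelLabel_nonpos_of_ne_one (aux v u _ h.flip)
    have l0 := h.l_pos
    have l1 : 0 < 1 - l := by linarith [h.l_lt]
    rw [h.labelInterp_eq] at hH₁
    have k1 := mul_nonpos_of_nonneg_of_nonpos l1.le hu
    have k2 := mul_nonpos_of_nonneg_of_nonpos l0.le hv
    have e1 : (1 - l) * pixelLabel α T₁ u = 0 := by linarith
    have e2 : l * pixelLabel α T₁ v = 0 := by linarith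
    exact hx₁.1 (h.mem_boundaryPolygon ((mul_eq_zero.1 e1).resolve_left l1.ne')
      ((mul_eq_zero.1 e2).resolve_left l0.ne'))
  · obtain ⟨z, e, s, t, h, h₁, hgood⟩ := h.exists_frame hfin₁ hc₁ hx₁
    have h₂ : pixelLabel α T₂ z = 1 := by
      refine hone z h₁ fun h₂ => ?_
      refine (h.labelInterp_neg h₂ ?_).not_ge hH₂
      -- A corner labelled 1 for `T₁` is not labelled 0 for `T₂`, so the good position of `x`
      -- carries over to `T₂`.
      exact hgood.imp_right (Or.imp_right (Or.imp (hne _) (hne _)))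
    obtain ⟨D, hDfin, hzD, hle, hcl⟩ := hD z h₁ h₂
    refine hle.not_gt (h.labelInterp_pos (pixelLabel_eq_one_of_mem hDfin hzD)
      (pixelLabel_nonneg_of_adj_mem hDfin hzD h.adj_fst)
      (pixelLabel_nonneg_of_adj_mem hDfin hzD h.adj_snd) ?_)
    have hcorner : ∀ w, PixelAdj α z w → pixelLabel α T₁ w = 1 → w ∈ D := by
      intro w hzw hw₁
      refine hcl z hzD w hzw hw₁ (hone w hw₁ fun hw₂ => ?_)
      have := pixelLabel_nonneg_of_adj hzw h₂
      linarith
    -- Unless `s + t < 1`, the fourth corner is adjacent to a pixel of `D`: to `z` itself if `α =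
    -- .eight`, else to a side corner enclosed by both sets.
    rcases hgood with hst | rfl | hr | hu
    · exact Or.inr hst
    · exact Or.inl (pixelLabel_nonneg_of_adj_mem hDfin hzD h.adj_diag)
    · exact Or.inl (pixelLabel_nonneg_of_adj_mem hDfin (hcorner _ h.adj_fst hr) h.flip_fst.adj_snd)
    · exact Or.inl (pixelLabel_nonneg_of_adj_mem hDfin (hcorner _ h.adj_snd hu) h.flip_snd.adj_fst)

/-- A component that does not lie in the exterior region of another one is nested in it. -/
theorem mem_nestedFamily_of_not_exterior {I : BinaryImage} (hT₁ : I.IsWhiteComponent α T₁)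
    (hT₂ : I.IsWhiteComponent α T₂) (hfin₁ : T₁.Finite) (hne : T₁ ≠ T₂)
    (h : ¬T₂ ⊆ exteriorRegion α T₁) : T₂ ∈ nestedFamily α T₁ := by
  obtain ⟨hw₂, hn₂, hc₂⟩ := BinaryImage.isWhiteConnected_iff.1 hT₂.prop
  have hdisj := Set.disjoint_right.1 (hT₁.disjoint_of_ne hT₂ hne)
  -- By maximality of `T₁`, a white pixel of `I` adjacent to `T₁` belongs to it.
  have hP : ∀ u ∈ T₂, u ∉ sitePerimeter α T₁ := by
    rintro u hu ⟨hu₁, t, ht, hut⟩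
    exact hu₁ (hT₁.mem_of_adj ht (hw₂ hu) hut.symm)
  have hE := (subset_exteriorRegion_or_disjoint hc₂ hP).resolve_left h
  refine ⟨BinaryImage.isWhiteConnected_iff.2
    ⟨fun u hu => mem_white_charImage.2 (hP u hu), hn₂, hc₂⟩, fun u hu => ⟨?_, hdisj hu⟩⟩
  exact mem_latticeRegion_of_label_eq_one hfin₁
    (pixelLabel_eq_one.2 ⟨hE u hu, fun hp => hP u hu hp.1⟩)

end Tiles

theorem lemma6p2 (α : Connectivity) (I : BinaryImage) (T₁ T₂ : Set (ℤ × ℤ))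
    (hT₁ : I.IsWhiteComponent α T₁) (hT₂ : I.IsWhiteComponent α T₂)
    (hfin₁ : T₁.Finite) (hfin₂ : T₂.Finite) (hne : T₁ ≠ T₂) :
    polygonalTile α T₁ ∩ polygonalTile α T₂ = ∅ := by
  rw [Set.eq_empty_iff_forall_notMem]
  rintro x ⟨hx₁, hx₂⟩
  by_cases h₂₁ : T₂ ⊆ exteriorRegion α T₁
  · by_cases h₁₂ : T₁ ⊆ exteriorRegion α T₂
    · exact disjoint_polygonalTile_of_exterior hfin₁ hfin₂
        (BinaryImage.isWhiteConnected_iff.1 hT₁.prop).2.2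
        (BinaryImage.isWhiteConnected_iff.1 hT₂.prop).2.2 h₁₂ h₂₁ hx₁ hx₂.1
    · exact hx₂.2 (Set.mem_biUnion
        (mem_nestedFamily_of_not_exterior hT₂ hT₁ hfin₂ hne.symm h₁₂) hx₁.1)
  · exact hx₁.2 (Set.mem_biUnion (mem_nestedFamily_of_not_exterior hT₁ hT₂ hfin₁ hne h₂₁) hx₂.1)
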